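/- Let $\mathbb F_{q^s}$ be a finite field, $\theta$ an automorphism of $\mathbb F_{q^s}$ with fixed field $\mathbb F_q$, and $\mathcal R=\mathbb F_{q^s}[x;\theta]$ the skew polynomial ring ($xa=\theta(a)x$), with evaluation $f(\alpha)=\sum_i f_i\theta^i(\alpha)$ for $f=\sum_i f_ix^i$. For a vector $\mathbf v$ over $\mathcal R$, its leading position is the rightmost index where the maximal degree of the entries is attained. A matrix over $\mathcal R$ is in weak Popov form if its non-zero rows have pairwise different leading positions. For a shift $\mathbf w\in\mathbb Z_{\ge0}^{\ell+1}$ put $\Phi_{\mathbf w}(\mathbf u)=(u_0x^{w_0},\dots,u_\ell x^{w_\ell})$, $\deg_{\mathbf w}\mathbf u=\deg\Phi_{\mathbf w}(\mathbf u)$, and let $\mathrm{LP}_{\mathbf w}(\mathbf u)$ be the leading position of $\Phi_{\mathbf w}(\mathbf u)$. A matrix $W$ is a $\mathbf w$-shifted weak Popov form of $V$ if $W$ and $V$ have the same left $\mathcal R$-row space and $\Phi_{\mathbf w}(W)$ (row-wise) is in weak Popov form. Let $\ell,k,n\ge 1$ with $\binom{\ell+1}{2}(k-1)<n\le s$, let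 $x_1,\dots,x_n\in\mathbb F_{q^s}$ be linearly independent over $\mathbb F_q$, and let $y_{i,t}\in\mathbb F_{q^s}$ ($1\le i\le n$, $1\le t\le\ell$) be arbitrary. Let $G\in\mathcal R$ be the annihilator polynomial of the $x_i$ (monic, of minimal degree among the non-zero polynomials vanishing at all $x_i$), let $R_t\in\mathcal R$ be the polynomial of degree less than $n$ with $R_t(x_i)=y_{i,t}$ for all $i$, and let $$M=\begin{pmatrix}G&0&\cdots&0\\-R_1&1&&\\ \vdots&&\ddots&\\-R_\ell&&&1\end{pmatrix}\in\mathcal R^{(\ell+1)\times(\ell+1)} ,\qquad \mathbf w=(0,k-1,2(k-1),\dots,\ell(k-1)).$$ A simple transformation $i$ on $j$ at position $0$ (when $\deg v_{i,0}\le\deg v_{j,0}$) replaces row $\mathbf v_j$ by $\mathbf v_j-\alpha x^\beta\mathbf v_i$, where $\beta=\deg v_{j,0}-\deg v_{i,0}$ and $\alpha=\mathrm{LC}(v_{j,0})/\theta^\beta(\mathrm{LC}(v_{i,0}))$. One step of the weak Popov walk for a shift $\mathbf u$ lists the rows $i$ with $\mathrm{LP}_{\mathbf u+(1,0,\dots,0)}(\mathbf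 v_i)=0$ as $i_1,\dots,i_r$ by increasing $\mathrm{LP}_{\mathbf u}(\mathbf v_i)$, puts $t=i_1$, and for $i=i_2,\dots,i_r$ in turn applies the simple transformation $t$ on $i$ at position $0$ if $\deg v_{t,0}\le\deg v_{i,0}$, and otherwise the simple transformation $i$ on $t$ at position $0$ followed by $t\leftarrow i$. The weak Popov walk performs $n$ such steps on its input $V\leftarrow M$, for the shifts $\mathbf u=\mathbf w+(j,n,\dots,n)$, $j=0,\dots,n-1$. Complexity counts the operations $+,-,\cdot,/$ and $\theta^i$ in $\mathbb F_{q^s}$; polynomials are stored by their coefficients, and coefficients that are zero are skipped in simple transformations. Theorem. There is an absolute constant $C$ such that for all such data: (1) The weak Popov walk is correct: applied to $M$, it returns a $\mathbf w$-shifted weak Popov form of $M$. It uses at most $C\,\ell n^2$ operations over $\mathbb F_{q^s}$. (2) The interpolation step of list-$\ell$ decoding of Mahdavifar--Vardy codes, carried out by setting up $M$ (computing $G$ and the $R_t$ by Newton interpolation), applying the weak Popov walk, and returning a row of minimal $\mathbf w$-shifted degree $\deg_{\mathbf w}$, uses at most $C\,\ell n^2$ operations over $\mathbb F_{q^s}$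 in total. The matrix it sets up is $M$, and the row $(Q_0,\dots,Q_\ell)$ it returns solves the interpolation problem: it is non-zero, $Q_0(x_i)+\sum_{t=1}^{\ell}Q_t(y_{i,t})=0$ for $i=1,\dots,n$, and $\deg Q_t<\chi-t(k-1)$ for $t=0,\dots,\ell$, where $\chi=\left\lceil\frac{n+1}{\ell+1}+\frac12\ell(k-1)\right\rceil$. -/

import Mathlib

namespace SkewWalk

/-! ## Skew polynomials

`SkewPolynomial K` is Mathlib's ring `K[x; θ]` with `x a = θ(a) x`; the endomorphism `θ` of `K` is
given by an action of `Multiplicative ℕ`, and `Multiplicative.ofAdd i • a` is `θ^i(a)`.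
For a finite field `K` every ring endomorphism is an automorphism. -/

section SkewPolynomials

variable {K : Type*} [Field K]

/-- The degree of a skew polynomial, with `deg 0 = ⊥`. -/
def degree (f : SkewPolynomial K) : WithBot ℕ := f.support.max

/-- The leading position among entries of degrees `d`: the rightmost index at which the maximal
degree is attained (`⊥` if all entries are zero). -/
def leadingPosition {m : ℕ} (d : Fin m → WithBot ℕ) : WithBot (Fin m) :=
  (Finset.univ.filter fun i => d i ≠ ⊥ ∧ d i = Finset.univ.sup d).max

/-- Weak Popov form: the leading positions of the non-zero rows are pairwise different. -/
def IsWeakPopov {r m : ℕ} (V : Fin r → Fin m → SkewPolynomial K) : Prop :=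
  ∀ i j, V i ≠ 0 → V j ≠ 0 →
    leadingPosition (fun c => degree (V i c)) = leadingPosition (fun c => degree (V j c)) → i = j

variable [MulSemiringAction (Multiplicative ℕ) K]

/-- The (operator) evaluation `f(α) = ∑ i, f_i θ^i(α)`. -/
noncomputable def evalAt (f : SkewPolynomial K) (α : K) : K :=
  f.sum fun i a => a * (Multiplicative.ofAdd i • α)

/-- The map `Φ_w : (u_0, …, u_{m-1}) ↦ (u_0 x^{w_0}, …, u_{m-1} x^{w_{m-1}})`. -/
noncomputable def shiftRow {m : ℕ} (w : Fin m → ℕ) (u : Fin m → SkewPolynomial K) :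
    Fin m → SkewPolynomial K :=
  fun c => u c * SkewPolynomial.X ^ w c

/-- `w`-shifted weak Popov form. -/
def IsShiftedWeakPopov {r m : ℕ} (w : Fin m → ℕ) (V : Fin r → Fin m → SkewPolynomial K) : Prop :=
  IsWeakPopov fun i => shiftRow w (V i)

/-- The left `K[x; θ]`-module generated by the rows. -/
noncomputable def rowSpace {r m : ℕ} (V : Fin r → Fin m → SkewPolynomial K) :
    Submodule (SkewPolynomial K) (Fin m → SkewPolynomial K) :=
  Submodule.span (SkewPolynomial K) (Set.range V)

/-- `W` is a `w`-shifted weak Popov form of `V`. -/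
def IsShiftedWeakPopovFormOf {r m : ℕ} (w : Fin m → ℕ)
    (W V : Fin r → Fin m → SkewPolynomial K) : Prop :=
  IsShiftedWeakPopov w W ∧ rowSpace W = rowSpace V

/-! ## The interpolation problem and its explicit basis -/

/-- `G` is the annihilator polynomial of the `x i`: the monic polynomial of minimal degree among
the non-zero polynomials vanishing at all `x i`. -/
def IsAnnihilatorPoly {n : ℕ} (x : Fin n → K) (G : SkewPolynomial K) : Prop :=
  (∃ d : ℕ, degree G = d ∧ G.coeff d = 1) ∧ (∀ i, evalAt G (x i) = 0) ∧
    ∀ B : SkewPolynomial K, B ≠ 0 → (∀ i, evalAt B (x i) = 0) → degree G ≤ degree B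

/-- `R` is the interpolation polynomial: `deg R < n` and `R(x i) = y i` for all `i`. -/
def IsInterpolationPoly {n : ℕ} (x y : Fin n → K) (R : SkewPolynomial K) : Prop :=
  degree R < n ∧ ∀ i, evalAt R (x i) = y i

/-- The matrix with first row `(G, 0, …, 0)` and rows `(-R_t, 0, …, 0, 1, 0, …, 0)`, the `1` being
in column `t`, for `t = 1, …, ℓ` (`R t` stands for `R_{t+1}`). -/
noncomputable def mvMatrix {ℓ : ℕ} (G : SkewPolynomial K) (R : Fin ℓ → SkewPolynomial K) :
    Fin (ℓ + 1) → Fin (ℓ + 1) → SkewPolynomial K :=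
  Fin.cons (Fin.cons G fun _ => 0)
    fun t => Fin.cons (-R t) fun u => if u = t then 1 else 0

/-- `χ = ⌈(n + 1) / (ℓ + 1) + ℓ (k - 1) / 2⌉`. -/
def chi (ℓ k n : ℕ) : ℕ := ⌈((n : ℚ) + 1) / (ℓ + 1) + (ℓ : ℚ) * ((k : ℚ) - 1) / 2⌉₊

/-- The shift `(0, k - 1, 2 (k - 1), …, ℓ (k - 1))`. -/
def mvShift (ℓ k : ℕ) : Fin (ℓ + 1) → ℕ := fun t => t * (k - 1)

/-- `Q` solves the interpolation step: `Q ≠ 0`,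
`Q_0(x_i) + ∑_{t=1}^ℓ Q_t(y_{i,t}) = 0` for all `i`, and `deg Q_t < χ - t (k - 1)` for all `t`
(`y i t` stands for `y_{i,t+1}`). -/
def SolvesInterpolation {ℓ n : ℕ} (k : ℕ) (x : Fin n → K) (y : Fin n → Fin ℓ → K)
    (Q : Fin (ℓ + 1) → SkewPolynomial K) : Prop :=
  Q ≠ 0 ∧ (∀ i, evalAt (Q 0) (x i) + ∑ t : Fin ℓ, evalAt (Q t.succ) (y i t) = 0) ∧
    ∀ t, degree (Q t) + (mvShift ℓ k t : WithBot ℕ) < (chi ℓ k n : WithBot ℕ)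

end SkewPolynomials

/-! ## Computations that count field operations

Algorithms are written for an arbitrary type `V` of field elements, which they can access only
through a `FieldOps V`.  In the interpretation `fieldOps K` every application of
`+`, `-`, `·`, `/` or `θ^i` costs one operation; the constants `0` and `1`, zero tests, moving data
around and the arithmetic of degrees and indices are not operations in the field. -/

/-- A result together with the number of field operations spent on it. -/
structure Counted (α : Type*) where
  /-- the result -/
  val : α
  /-- the number of field operations -/
  ops : ℕ

instance : Monad Counted where
  pure a := ⟨a, 0⟩
  bind p f :=
    let q := f p.val
    ⟨q.val, p.ops + q.ops⟩

/-- Perform the computations `f i` one after the other and collect the results. -/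
def Counted.pi {m : ℕ} {α : Type*} (f : Fin m → Counted α) : Counted (Fin m → α) :=
  ⟨fun i => (f i).val, ∑ i, (f i).ops⟩

/-- The operations through which an algorithm accesses field elements. -/
structure FieldOps (V : Type*) where
  /-- the constant `0` -/
  zero : V
  /-- the constant `1` -/
  one : V
  /-- test for zero -/
  isZero : V → Bool
  /-- addition -/
  add : V → V → Counted V
  /-- subtraction -/
  sub : V → V → Counted V
  /-- multiplication -/
  mul : V → V → Counted V
  /-- division -/
  div : V → V → Counted V
  /-- `theta i` applies `θ^i` -/
  theta : ℕ → V → Counted V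

/-- The field `K` with its automorphism `θ`; each operation is counted once. -/
def fieldOps (K : Type*) [Field K] [DecidableEq K] [MulSemiringAction (Multiplicative ℕ) K] :
    FieldOps K where
  zero := 0
  one := 1
  isZero a := decide (a = 0)
  add a b := ⟨a + b, 1⟩
  sub a b := ⟨a - b, 1⟩
  mul a b := ⟨a * b, 1⟩
  div a b := ⟨a / b, 1⟩
  theta i a := ⟨Multiplicative.ofAdd i • a, 1⟩

/-- Matrices whose entries are polynomials, stored as lists of coefficients, constant coefficient
first (trailing zeros are allowed). -/
abbrev PolyMatrix (V : Type*) (ℓ : ℕ) := Fin (ℓ + 1) → Fin (ℓ + 1) → List V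

/-- The skew polynomial stored by a list of coefficients. -/
noncomputable def toSkew {K : Type*} [Field K] (p : List K) : SkewPolynomial K :=
  ∑ i ∈ Finset.range p.length, SkewPolynomial.monomial i (p.getD i 0)

/-- The matrix of skew polynomials stored by a matrix of coefficient lists. -/
noncomputable def toMatrix {K : Type*} [Field K] {ℓ : ℕ} (V : PolyMatrix K ℓ) :
    Fin (ℓ + 1) → Fin (ℓ + 1) → SkewPolynomial K :=
  fun i c => toSkew (V i c)

section Algorithms

variable {V : Type*} (O : FieldOps V)

/-- The degree of a stored polynomial. -/
def deg : List V → WithBot ℕ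
  | [] => ⊥
  | a :: p => max (if O.isZero a then ⊥ else 0) (deg p + 1)

/-- The leading coefficient of a stored polynomial. -/
def leadingCoeff (p : List V) : V := p.getD ((deg O p).unbotD 0) O.zero

/-- `q - α · θ^β(p)`, where `θ^β` acts on the coefficients; zero coefficients of `p` are skipped. -/
def subScaled (α : V) (β : ℕ) : List V → List V → Counted (List V)
  | [], q => pure q
  | a :: p, q => do
    let r ← subScaled α β p q.tail
    let b := q.headD O.zero
    if O.isZero a then
      pure (b :: r)
    else do
      let s ← O.theta β a
      let u ← O.mul α s
      let c ← O.sub b u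
      pure (c :: r)

/-- `q - α x^β p`. -/
def subMonomialMul (α : V) (β : ℕ) (p q : List V) : Counted (List V) := do
  let r ← subScaled O α β p (q.drop β)
  pure ((List.range β).map (fun i => q.getD i O.zero) ++ r)

/-- `p(a) = ∑ i, p_i θ^i(a)`; the argument `i` is the index of the first coefficient in the list. -/
def evalList (a : V) : ℕ → List V → Counted V
  | _, [] => pure O.zero
  | i, c :: p => do
    let r ← evalList a (i + 1) p
    let s ← O.theta i a
    let u ← O.mul c s
    O.add u r

/-- `x · p`. -/
def mulX (p : List V) : Counted (List V) := do
  let r ← p.foldr (fun a (acc : Counted (List V)) => do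
    let r ← acc
    let s ← O.theta 1 a
    pure (s :: r)) (pure [])
  pure (O.zero :: r)

/-- `-p`. -/
def negList (p : List V) : Counted (List V) := subMonomialMul O O.one 0 p []

/-- Newton interpolation.  Given the annihilator polynomial `A` and the interpolation polynomial
`R` of the points seen so far, process the remaining points `(a, b)` by
`R ← R + (b - R(a)) / A(a) · A` and `A ← (x - θ(A(a)) / A(a)) · A`. -/
def newton : List (V × V) → List V → List V → Counted (List V × List V)
  | [], A, R => pure (A, R)
  | (a, b) :: pts, A, R => do
    let e ← evalList O a 0 A
    let r ← evalList O a 0 R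
    let d ← O.sub r b
    let c ← O.div d e
    let R' ← subMonomialMul O c 0 A R
    let f ← O.theta 1 e
    let g ← O.div f e
    let xA ← mulX O A
    let A' ← subMonomialMul O g 0 A xA
    newton pts A' R'

/-- Set up the matrix `mvMatrix G R` from the interpolation points. -/
def mvBasis {ℓ n : ℕ} (x : Fin n → V) (y : Fin n → Fin ℓ → V) : Counted (PolyMatrix V ℓ) := do
  let AR ← newton O (List.ofFn fun i => (x i, O.zero)) [O.one] []
  let S ← Counted.pi fun t : Fin ℓ => do
    let AR ← newton O (List.ofFn fun i => (x i, y i t)) [O.one] []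
    negList O AR.2
  pure (Fin.cons (Fin.cons AR.1 fun _ => [])
    fun t => Fin.cons (S t) fun u => if u = t then [O.one] else [])

/-- The simple transformation `i` on `j` at position `h`: replace row `v_j` by `v_j - α x^β v_i`,
where `β = deg v_{j,h} - deg v_{i,h}` and `α = LC(v_{j,h}) / θ^β(LC(v_{i,h}))`. -/
def simpleTransformation {ℓ : ℕ} (i j h : Fin (ℓ + 1)) (M : PolyMatrix V ℓ) :
    Counted (PolyMatrix V ℓ) := do
  let β := (deg O (M j h)).unbotD 0 - (deg O (M i h)).unbotD 0
  let s ← O.theta β (leadingCoeff O (M i h))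
  let α ← O.div (leadingCoeff O (M j h)) s
  let r ← Counted.pi fun c => subMonomialMul O α β (M i c) (M j c)
  pure (Function.update M j r)

/-- The degrees of the entries of a `w`-shifted row. -/
def shiftedDegrees {ℓ : ℕ} (w : Fin (ℓ + 1) → ℕ) (v : Fin (ℓ + 1) → List V) :
    Fin (ℓ + 1) → WithBot ℕ :=
  fun c => deg O (v c) + (w c : WithBot ℕ)

/-- The loop of the weak Popov walk: `t` is the current pivot row, the list holds the rows that
remain to be treated. -/
def sweep {ℓ : ℕ} : Fin (ℓ + 1) → List (Fin (ℓ + 1)) → PolyMatrix V ℓ → Counted (PolyMatrix V ℓ)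
  | _, [], M => pure M
  | t, i :: is, M =>
    if deg O (M t 0) ≤ deg O (M i 0) then do
      let M' ← simpleTransformation O t i 0 M
      sweep t is M'
    else do
      let M' ← simpleTransformation O i t 0 M
      sweep i is M'

/-- One step of the weak Popov walk, from the shift `w` to the shift `w + (1, 0, …, 0)`. -/
def weakPopovWalk {ℓ : ℕ} (M : PolyMatrix V ℓ) (w : Fin (ℓ + 1) → ℕ) :
    Counted (PolyMatrix V ℓ) :=
  let h : Fin (ℓ + 1) → WithBot (Fin (ℓ + 1)) :=
    fun i => leadingPosition (shiftedDegrees O w (M i))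
  let I : List (Fin (ℓ + 1)) := (List.finRange (ℓ + 1)).filter fun i =>
    leadingPosition (shiftedDegrees O (w + Pi.single 0 1) (M i)) = ((0 : Fin (ℓ + 1)) : WithBot _)
  match I.insertionSort (fun i j => h i ≤ h j) with
  | [] => pure M
  | t :: is => sweep O t is M

/-- `N` successive steps of the weak Popov walk, starting from the shift `w`. -/
def walkSteps {ℓ : ℕ} : ℕ → (Fin (ℓ + 1) → ℕ) → PolyMatrix V ℓ → Counted (PolyMatrix V ℓ)
  | 0, _, M => pure M
  | N + 1, w, M => do
    let M' ← weakPopovWalk O M w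
    walkSteps N (w + Pi.single 0 1) M'

/-- The weak Popov walk for the interpolation problem: `n` steps, starting from the shift
`(0, k - 1, …, ℓ (k - 1)) + (0, n, …, n)`. -/
def mvWalk {ℓ : ℕ} (k n : ℕ) (M : PolyMatrix V ℓ) : Counted (PolyMatrix V ℓ) :=
  walkSteps O n (mvShift ℓ k + fun t => if t = 0 then 0 else n) M

/-- The interpolation step: set up the explicit basis, transform it into shifted weak Popov form by
the weak Popov walk, and return a row of minimal shifted degree. -/
def mvInterpolation {ℓ n : ℕ} (k : ℕ) (x : Fin n → V) (y : Fin n → Fin ℓ → V) :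
    Counted (Fin (ℓ + 1) → List V) := do
  let M ← mvBasis O x y
  let W ← mvWalk O k n M
  pure (W (((List.finRange (ℓ + 1)).argmin fun i =>
    Finset.univ.sup (shiftedDegrees O (mvShift ℓ k) (W i))).getD 0))

end Algorithms

end SkewWalk

open SkewWalk

namespace SkewWalk

universe u

/-! Correctness. For the initial shift, which is at least `n` outside position `0`, the matrix `M`
is already in weak Popov form because `deg R_t < n`. After `n` increments at position `0` the shift
is `w + (n, …, n)`, which has the same leading positions as `w`. It remains to see that one step of
the walk repairs the form when the shift grows by one at position `0`. This growth keeps the leading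
position of a row or moves it to `0`, and the rows moved (or already there) attain their shifted
degree in column `0`. A simple transformation cancels that top coefficient; as the two old leading
positions differ, the larger one survives as the leading position of the new row (`IsLead.reduce`).
The rows are treated by increasing leading position, so the pivot always has the smaller one, and
the transformed row inherits the position of the row just treated. Thus the positions are only
permuted, and the last pivot keeps `0` (`SweepState.sweep`, `WalkState.step`).

Cost. Two quantities control the sizes of the rows. The shifted degrees satisfy `∑ d_j ≤ n + ∑ u_c`,
so the excesses of the `d_j` over the shifts at the leading positions sum to at most `n`. Let `T`
collect the rows that became pivots by a change of pivot. Such a change strictly lowers the pivot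
degree `d_t`, and from step to step `d_t` and `u_0` grow together, so `|T| + d_t ≤ n + u_0`, whence
`|T| ≤ n` since `u_0 ≤ d_t`. Only column `0` and the columns in `T` carry off-diagonal entries.
Together with `binom(ℓ+1,2) (k-1) < n`, which bounds the total spread of the shift, this gives `O(ℓ
n)` operations per step (`WalkState.sum_rowCost_le`).

Interpolation. Newton's method works because the kernel of the current annihilator lies in the span
of the points seen, so it does not vanish at the next one (`NewtonState.step`). The interpolation
conditions define a left module containing the rows of `M`, hence every row the walk produces. The
final degrees sum to at most `n + ∑ w_c`, so the smallest is at most the average, which is less than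
`χ` (`lt_chi`). -/

@[simp] theorem Counted.bind_val {α β : Type u} (p : Counted α) (f : α → Counted β) :
    (p >>= f).val = (f p.val).val := rfl

@[simp] theorem Counted.bind_ops {α β : Type u} (p : Counted α) (f : α → Counted β) :
    (p >>= f).ops = p.ops + (f p.val).ops := rfl

@[simp] theorem Counted.pure_val {α : Type*} (a : α) : (pure a : Counted α).val = a := rfl

@[simp] theorem Counted.pure_ops {α : Type*} (a : α) : (pure a : Counted α).ops = 0 := rfl

/-! ### Coefficient lists: degree, sparsity and cost of subtraction. -/

section ListPolynomials

variable {K : Type*} [Field K] [DecidableEq K]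

/-- The number of non-zero coefficients. -/
def nnz (p : List K) : ℕ := p.countP (fun a => a ≠ 0)

theorem nnz_eq_zero_of_forall {p : List K} (h : ∀ m, p.getD m 0 = 0) : nnz p = 0 := by
  induction p with
  | nil => rfl
  | cons a p ih =>
    have ha : a = 0 := by simpa using h 0
    have := ih fun m => by simpa using h (m + 1)
    simpa [nnz, ha] using this

theorem nnz_le_of_forall_lt {p : List K} {e : ℕ} (h : ∀ m, p.getD m 0 ≠ 0 → m < e) :
    nnz p ≤ e := by
  induction p generalizing e with
  | nil => simp [nnz]
  | cons a p ih =>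
    cases e with
    | zero =>
      exact (nnz_eq_zero_of_forall fun m => by
        by_contra hm
        exact absurd (h m hm) (by omega)).le
    | succ e =>
      have := ih (e := e) fun m hm => by
        have := h (m + 1) (by simpa using hm)
        omega
      simp only [nnz, List.countP_cons] at this ⊢
      split_ifs <;> omega

theorem nnz_le_length (p : List K) : nnz p ≤ p.length := List.countP_le_length

variable [MulSemiringAction (Multiplicative ℕ) K]

section FieldOps

variable (a b : K) (i : ℕ)

@[simp] theorem fieldOps_zero : (fieldOps K).zero = 0 := rfl

@[simp] theorem fieldOps_one : (fieldOps K).one = 1 := rfl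

@[simp] theorem fieldOps_isZero : (fieldOps K).isZero a = decide (a = 0) := rfl

@[simp] theorem fieldOps_add : (fieldOps K).add a b = ⟨a + b, 1⟩ := rfl

@[simp] theorem fieldOps_sub : (fieldOps K).sub a b = ⟨a - b, 1⟩ := rfl

@[simp] theorem fieldOps_mul : (fieldOps K).mul a b = ⟨a * b, 1⟩ := rfl

@[simp] theorem fieldOps_div : (fieldOps K).div a b = ⟨a / b, 1⟩ := rfl

@[simp] theorem fieldOps_theta : (fieldOps K).theta i a = ⟨Multiplicative.ofAdd i • a, 1⟩ := rfl

end FieldOps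

/-- Describing a degree by its upper bounds absorbs both `⊥` and stored trailing zeros; the parallel
`degree_le_iff` then identifies the two notions of degree. -/
theorem deg_le_iff (p : List K) (e : WithBot ℕ) :
    deg (fieldOps K) p ≤ e ↔ ∀ m, p.getD m 0 ≠ 0 → (m : WithBot ℕ) ≤ e := by
  induction p generalizing e with
  | nil => simp [deg]
  | cons a p ih =>
    have key : deg (fieldOps K) p + 1 ≤ e ↔ ∀ m, p.getD m 0 ≠ 0 → ((m + 1 : ℕ) : WithBot ℕ) ≤ e := by
      induction e with
      | bot =>
        have := ih ⊥
        rw [le_bot_iff] at this ⊢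
        simp only [WithBot.add_eq_bot, WithBot.one_ne_bot, or_false, this]
        simp
      | coe e =>
        cases e with
        -- An upper bound `0` for `deg p + 1` leaves only `deg p = ⊥`.
        | zero =>
          have := ih ⊥
          constructor
          · intro h m hm
            have h1 := (ih _).1 le_rfl m hm
            exact (add_le_add_left h1 1).trans h
          · intro h
            have h0 : ∀ m, p.getD m 0 ≠ 0 → (m : WithBot ℕ) ≤ ⊥ := fun m hm => by
              have h1 := h m hm
              norm_cast at h1
            rw [le_bot_iff.1 (this.2 h0)]
            simp
        | succ e =>
          have h1 : deg (fieldOps K) p + 1 ≤ ((e + 1 : ℕ) : WithBot ℕ) ↔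
              deg (fieldOps K) p ≤ e := by
            generalize deg (fieldOps K) p = x
            cases x with
            | bot => simp
            | coe d =>
              change ((d + 1 : ℕ) : WithBot ℕ) ≤ _ ↔ ((d : ℕ) : WithBot ℕ) ≤ _
              simp only [Nat.cast_le, Nat.add_le_add_iff_right]
          refine (h1.trans (ih _)).trans (forall₂_congr fun m _ => ?_)
          change (m : WithBot ℕ) ≤ (e : ℕ) ↔ ((m + 1 : ℕ) : WithBot ℕ) ≤ ((e + 1 : ℕ) : WithBot ℕ)
          simp only [Nat.cast_le, Nat.add_le_add_iff_right]
    rw [deg, max_le_iff, key]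
    constructor
    · rintro ⟨h1, h2⟩ m hm
      cases m with
      | zero =>
        have ha : a ≠ 0 := by simpa using hm
        simpa [ha] using h1
      | succ m => exact h2 m (by simpa using hm)
    · intro h
      constructor
      · by_cases ha : a = 0
        · simp [ha]
        · have := h 0 (by simpa using ha)
          simpa [ha] using this
      · intro m hm
        exact h (m + 1) (by simpa using hm)

theorem le_deg {p : List K} {m : ℕ} (hm : p.getD m 0 ≠ 0) :
    (m : WithBot ℕ) ≤ deg (fieldOps K) p :=
  (deg_le_iff p _).1 le_rfl m hm

theorem deg_eq_bot_iff {p : List K} : deg (fieldOps K) p = ⊥ ↔ ∀ m, p.getD m 0 = 0 := by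
  rw [← le_bot_iff, deg_le_iff]
  simp

theorem getD_ne_zero_of_deg_eq {p : List K} {e : ℕ} (h : deg (fieldOps K) p = e) :
    p.getD e 0 ≠ 0 := by
  intro h0
  have hle : ∀ m, p.getD m 0 ≠ 0 → m < e := fun m hm => by
    have h1 := le_deg hm
    rw [h] at h1
    have h2 : m ≤ e := by exact_mod_cast h1
    rcases h2.lt_or_eq with h3 | rfl
    · exact h3
    · exact absurd h0 hm
  cases e with
  | zero =>
    have : deg (fieldOps K) p = ⊥ := deg_eq_bot_iff.2 fun m => by
      by_contra hm
      exact absurd (hle m hm) (by omega)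
    rw [this] at h
    cases h
  | succ e =>
    have : deg (fieldOps K) p ≤ (e : WithBot ℕ) := (deg_le_iff _ _).2 fun m hm => by
      have := hle m hm
      exact_mod_cast (by omega : m ≤ e)
    rw [h] at this
    have h4 : e + 1 ≤ e := by exact_mod_cast this
    omega

theorem deg_eq_coe_iff {p : List K} {e : ℕ} :
    deg (fieldOps K) p = e ↔ p.getD e 0 ≠ 0 ∧ ∀ m, p.getD m 0 ≠ 0 → m ≤ e := by
  constructor
  · intro h
    refine ⟨getD_ne_zero_of_deg_eq h, fun m hm => ?_⟩
    have := le_deg hm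
    rw [h] at this
    exact_mod_cast this
  · rintro ⟨h1, h2⟩
    refine le_antisymm ((deg_le_iff _ _).2 fun m hm => ?_) (le_deg h1)
    exact_mod_cast h2 m hm

/-- One `θ^β`, one product and one difference for each non-zero coefficient; this is where sparsity
of the rows enters the cost. -/
theorem subScaled_ops (α : K) (β : ℕ) (p q : List K) :
    (subScaled (fieldOps K) α β p q).ops = 3 * nnz p := by
  induction p generalizing q with
  | nil => simp [subScaled, nnz]
  | cons a p ih =>
    by_cases ha : a = 0
    · simpa [subScaled, nnz, ha] using ih q.tail
    · have := ih q.tail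
      simp [subScaled, nnz, ha, this]
      ring

theorem subScaled_getD (α : K) (β : ℕ) (p q : List K) (m : ℕ) :
    (subScaled (fieldOps K) α β p q).val.getD m 0 =
      q.getD m 0 - α * (Multiplicative.ofAdd β • p.getD m 0) := by
  induction p generalizing q m with
  | nil => simp [subScaled]
  | cons a p ih =>
    have hq : ∀ m, q.tail.getD m 0 = q.getD (m + 1) 0 := fun m => by cases q <;> simp
    by_cases ha : a = 0
    · cases m with
      | zero => cases q <;> simp [subScaled, ha]
      | succ m =>
        have := ih q.tail m
        rw [hq] at this
        simpa [subScaled, ha] using this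
    · cases m with
      | zero => cases q <;> simp [subScaled, ha]
      | succ m =>
        have := ih q.tail m
        rw [hq] at this
        simpa [subScaled, ha] using this

theorem subScaled_length (α : K) (β : ℕ) (p q : List K) :
    (subScaled (fieldOps K) α β p q).val.length = max p.length q.length := by
  induction p generalizing q with
  | nil => simp [subScaled]
  | cons a p ih =>
    have h : (subScaled (fieldOps K) α β (a :: p) q).val.length =
        (subScaled (fieldOps K) α β p q.tail).val.length + 1 := by
      by_cases ha : a = 0 <;> simp [subScaled, ha]
    rw [h, ih]
    cases q <;> simp

theorem subMonomialMul_ops (α : K) (β : ℕ) (p q : List K) :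
    (subMonomialMul (fieldOps K) α β p q).ops = 3 * nnz p := by
  simp [subMonomialMul, subScaled_ops]

theorem subMonomialMul_getD (α : K) (β : ℕ) (p q : List K) (m : ℕ) :
    (subMonomialMul (fieldOps K) α β p q).val.getD m 0 =
      q.getD m 0 - if β ≤ m then α * (Multiplicative.ofAdd β • p.getD (m - β) 0) else 0 := by
  simp only [subMonomialMul, Counted.bind_val, Counted.pure_val]
  split_ifs with h
  · rw [List.getD_append_right _ _ _ _ (by simpa using h)]
    simp only [List.length_map, List.length_range, subScaled_getD]
    congr 1
    simp [List.getD_eq_getElem?_getD, List.getElem?_drop, Nat.add_sub_cancel' h]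
  · rw [List.getD_append _ _ _ _ (by simpa using h)]
    rw [not_le] at h
    simp [List.getD_eq_getElem?_getD, List.getElem?_range h]

theorem subMonomialMul_zero_length (α : K) (p q : List K) :
    (subMonomialMul (fieldOps K) α 0 p q).val.length = max p.length q.length := by
  simp [subMonomialMul, subScaled_length]

end ListPolynomials

/-! ### Skew polynomials stored by coefficient lists. -/

section Skew

open SkewPolynomial

variable {K : Type*} [Field K]

theorem toSkew_coeff (p : List K) (m : ℕ) : (toSkew p).coeff m = p.getD m 0 := by
  have hs : ∀ s : Finset ℕ, (∑ i ∈ s, monomial i (p.getD i 0)).coeff m =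
      if m ∈ s then p.getD m 0 else 0 := by
    intro s
    induction s using Finset.induction_on with
    | empty => simp
    | insert a s ha ih =>
      rw [Finset.sum_insert ha, SkewPolynomial.coeff_add, ih, coeff_monomial]
      by_cases h : a = m
      · subst h
        simp [ha]
      · have : m ≠ a := fun h' => h h'.symm
        simp [h, this]
  rw [toSkew, hs]
  split_ifs with h
  · rfl
  · rw [Finset.mem_range, not_lt] at h
    rw [List.getD_eq_default _ _ h]

theorem degree_le_iff (f : SkewPolynomial K) (e : WithBot ℕ) :
    degree f ≤ e ↔ ∀ m, f.coeff m ≠ 0 → (m : WithBot ℕ) ≤ e := by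
  rw [degree, Finset.max_le_iff]
  simp only [SkewPolynomial.mem_support_iff]
  rfl

theorem degree_eq_coe_iff {f : SkewPolynomial K} {e : ℕ} :
    degree f = e ↔ f.coeff e ≠ 0 ∧ ∀ m, f.coeff m ≠ 0 → m ≤ e := by
  constructor
  · intro h
    have h1 := Finset.mem_of_max h
    refine ⟨SkewPolynomial.mem_support_iff.1 h1, fun m hm => ?_⟩
    exact_mod_cast (degree_le_iff f e).1 h.le m hm
  · rintro ⟨h1, h2⟩
    refine le_antisymm ((degree_le_iff _ _).2 fun m hm => ?_) ((degree_le_iff _ _).1 le_rfl e h1)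
    exact_mod_cast h2 m hm

/-- Multiplying by a power of `X` on the right applies no `θ` to the coefficients, so `Φ_w` merely
translates degrees. -/
theorem coeff_mul_X_pow [MulSemiringAction (Multiplicative ℕ) K] (f : SkewPolynomial K)
    (w m : ℕ) : (f * X ^ w).coeff (m + w) = f.coeff m := by
  rw [← monomial_one_right_eq_X_pow, monomial_def]
  refine (SkewMonoidAlgebra.coeff_mul_single_aux f (y := Multiplicative.ofAdd m) ?_).trans ?_
  · intro a
    rw [ofAdd_add, mul_right_cancel_iff]
  · simp [coeff]

theorem coeff_mul_X_pow_of_lt [MulSemiringAction (Multiplicative ℕ) K] (f : SkewPolynomial K)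
    {w m : ℕ} (h : m < w) : (f * X ^ w).coeff m = 0 := by
  rw [← monomial_one_right_eq_X_pow, monomial_def]
  refine SkewMonoidAlgebra.coeff_mul_single_of_not_exists_mul _ _ fun a ha => ?_
  have : m = a.toAdd + w := ha
  omega

theorem coeff_monomial_mul [MulSemiringAction (Multiplicative ℕ) K] (f : SkewPolynomial K)
    (β m : ℕ) (α : K) : (monomial β α * f).coeff m =
      if β ≤ m then α * (Multiplicative.ofAdd β • f.coeff (m - β)) else 0 := by
  rw [monomial_def]
  split_ifs with h
  · refine SkewMonoidAlgebra.coeff_single_mul_aux f (z := Multiplicative.ofAdd (m - β)) ?_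
    intro a
    rw [show (Multiplicative.ofAdd m) = Multiplicative.ofAdd β * Multiplicative.ofAdd (m - β) by
      rw [← ofAdd_add, Nat.add_sub_cancel' h], mul_left_cancel_iff]
  · refine SkewMonoidAlgebra.coeff_single_mul_of_not_exists_mul _ _ ?_
    rintro ⟨a, ha⟩
    have : m = β + a.toAdd := ha
    omega

theorem degree_mul_X_pow [MulSemiringAction (Multiplicative ℕ) K] (f : SkewPolynomial K) (w : ℕ) :
    degree (f * X ^ w) = degree f + (w : WithBot ℕ) := by
  cases h : degree f with
  | bot =>
    have h0 : f = 0 := by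
      have : f.support = ∅ := Finset.max_eq_bot.1 h
      exact SkewPolynomial.support_eq_empty.1 this
    rw [h0, zero_mul, WithBot.bot_add]
    simp [degree]
  | coe e =>
    have h' := degree_eq_coe_iff.1 h
    have : degree (f * X ^ w) = ((e + w : ℕ) : WithBot ℕ) := by
      refine degree_eq_coe_iff.2 ⟨by rw [coeff_mul_X_pow]; exact h'.1, fun m hm => ?_⟩
      by_cases hw : m < w
      · exact absurd (coeff_mul_X_pow_of_lt f hw) hm
      · obtain ⟨a, rfl⟩ := Nat.exists_eq_add_of_le' (not_lt.1 hw)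
        rw [coeff_mul_X_pow] at hm
        have := h'.2 a hm
        omega
    rw [this]
    rfl

variable [DecidableEq K] [MulSemiringAction (Multiplicative ℕ) K]

theorem toSkew_subMonomialMul (α : K) (β : ℕ) (p q : List K) :
    toSkew (subMonomialMul (fieldOps K) α β p q).val = toSkew q - monomial β α * toSkew p := by
  ext m
  rw [SkewPolynomial.coeff_sub, coeff_monomial_mul, toSkew_coeff, toSkew_coeff, toSkew_coeff,
    subMonomialMul_getD]

theorem degree_toSkew (p : List K) : degree (toSkew p) = deg (fieldOps K) p := by
  refine eq_of_forall_ge_iff fun e => ?_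
  rw [degree_le_iff, deg_le_iff]
  simp only [toSkew_coeff]

end Skew

/-! ### Leading positions as inequalities between natural numbers. -/

section LeadingPosition

theorem leadingPosition_eq_coe_iff {m : ℕ} {d : Fin m → WithBot ℕ} {h : Fin m} :
    leadingPosition d = h ↔ d h ≠ ⊥ ∧ (∀ c, d c ≤ d h) ∧ ∀ c, h < c → d c < d h := by
  constructor
  · intro hd
    have hm := (Finset.mem_filter.1 (Finset.mem_of_max hd)).2
    have hle : ∀ c, d c ≤ d h := fun c => hm.2 ▸ Finset.le_sup (Finset.mem_univ c)
    refine ⟨hm.1, hle, fun c hc => lt_of_le_of_ne (hle c) fun he => ?_⟩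
    have hmem : c ∈ Finset.univ.filter fun i => d i ≠ ⊥ ∧ d i = Finset.univ.sup d :=
      Finset.mem_filter.2 ⟨Finset.mem_univ _, he ▸ hm.1, he ▸ hm.2⟩
    have := Finset.le_max hmem
    rw [leadingPosition] at hd
    rw [hd] at this
    exact absurd (WithBot.coe_le_coe.1 this) (not_le.2 hc)
  · rintro ⟨h1, h2, h3⟩
    have hs : d h = Finset.univ.sup d :=
      le_antisymm (Finset.le_sup (Finset.mem_univ h)) (Finset.sup_le fun c _ => h2 c)
    refine le_antisymm (Finset.max_le fun c hc => WithBot.coe_le_coe.2 ?_)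
      (Finset.le_max (Finset.mem_filter.2 ⟨Finset.mem_univ _, h1, hs⟩))
    by_contra hlt
    have := h3 c (not_le.1 hlt)
    rw [(Finset.mem_filter.1 hc).2.2, hs] at this
    exact lt_irrefl _ this

variable {K : Type*} [Field K]

/-- The row `v` has `u`-shifted degree `e` and `u`-shifted leading position `h`. -/
structure IsLead {m : ℕ} (u : Fin m → ℕ) (v : Fin m → List K) (h : Fin m) (e : ℕ) : Prop where
  attained : ∃ a, (v h).getD a 0 ≠ 0 ∧ a + u h = e
  le : ∀ c a, (v c).getD a 0 ≠ 0 → a + u c ≤ e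
  lt : ∀ c a, h < c → (v c).getD a 0 ≠ 0 → a + u c < e

/-- The entry in column `0` of the row `v` has `u`-shifted degree at least `e`. -/
def HasTop {ℓ : ℕ} (u : Fin (ℓ + 1) → ℕ) (v : Fin (ℓ + 1) → List K) (e : ℕ) : Prop :=
  ∃ a, (v 0).getD a 0 ≠ 0 ∧ a + u 0 = e

variable [DecidableEq K] [MulSemiringAction (Multiplicative ℕ) K]

theorem deg_add_le_iff (p : List K) (u e : ℕ) :
    deg (fieldOps K) p + (u : WithBot ℕ) ≤ e ↔ ∀ a, p.getD a 0 ≠ 0 → a + u ≤ e := by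
  cases h : deg (fieldOps K) p with
  | bot =>
    have := deg_eq_bot_iff.1 h
    simp [-List.getD_eq_getElem?_getD, this]
  | coe b =>
    have hb := deg_eq_coe_iff.1 h
    change ((b + u : ℕ) : WithBot ℕ) ≤ _ ↔ _
    rw [Nat.cast_le]
    exact ⟨fun h a ha => (Nat.add_le_add_right (hb.2 a ha) u).trans h, fun h => h b hb.1⟩

theorem deg_add_lt_iff (p : List K) (u e : ℕ) :
    deg (fieldOps K) p + (u : WithBot ℕ) < e ↔ ∀ a, p.getD a 0 ≠ 0 → a + u < e := by
  cases h : deg (fieldOps K) p with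
  | bot =>
    have := deg_eq_bot_iff.1 h
    simp [-List.getD_eq_getElem?_getD, this]
  | coe b =>
    have hb := deg_eq_coe_iff.1 h
    change ((b + u : ℕ) : WithBot ℕ) < _ ↔ _
    rw [Nat.cast_lt]
    exact ⟨fun h a ha => (Nat.add_le_add_right (hb.2 a ha) u).trans_lt h, fun h => h b hb.1⟩

theorem isLead_iff_shiftedDegrees {ℓ : ℕ} {u : Fin (ℓ + 1) → ℕ} {v : Fin (ℓ + 1) → List K}
    {h : Fin (ℓ + 1)} {e : ℕ} :
    IsLead u v h e ↔ shiftedDegrees (fieldOps K) u v h = e ∧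
      (∀ c, shiftedDegrees (fieldOps K) u v c ≤ e) ∧
      ∀ c, h < c → shiftedDegrees (fieldOps K) u v c < e := by
  simp only [shiftedDegrees, deg_add_le_iff, deg_add_lt_iff]
  constructor
  · rintro ⟨⟨a, ha, hae⟩, h2, h3⟩
    refine ⟨?_, h2, fun c hc a => h3 c a hc⟩
    rw [deg_eq_coe_iff.2 ⟨ha, fun b hb => by have := h2 h b hb; omega⟩, ← hae]
    rfl
  · rintro ⟨h1, h2, h3⟩
    refine ⟨?_, h2, fun c a hc => h3 c hc a⟩
    cases hd : deg (fieldOps K) (v h) with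
    | bot =>
      rw [hd, WithBot.bot_add] at h1
      cases h1
    | coe b =>
      rw [hd] at h1
      exact ⟨b, (deg_eq_coe_iff.1 hd).1, WithBot.coe_injective h1⟩

theorem leadingPosition_shiftedDegrees_iff {ℓ : ℕ} {u : Fin (ℓ + 1) → ℕ}
    {v : Fin (ℓ + 1) → List K} {h : Fin (ℓ + 1)} :
    leadingPosition (shiftedDegrees (fieldOps K) u v) = h ↔ ∃ e, IsLead u v h e := by
  simp only [isLead_iff_shiftedDegrees]
  rw [leadingPosition_eq_coe_iff]
  constructor
  · rintro ⟨h1, h2, h3⟩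
    obtain ⟨e, he⟩ := WithBot.ne_bot_iff_exists.1 h1
    rw [← he] at h2 h3
    exact ⟨e, he.symm, h2, h3⟩
  · rintro ⟨e, h1, h2, h3⟩
    rw [h1]
    exact ⟨WithBot.natCast_ne_bot e, h2, h3⟩

theorem IsLead.leadingPosition {ℓ : ℕ} {u : Fin (ℓ + 1) → ℕ}
    {v : Fin (ℓ + 1) → List K} {h : Fin (ℓ + 1)} {e : ℕ} (hv : IsLead u v h e) :
    leadingPosition (shiftedDegrees (fieldOps K) u v) = h :=
  leadingPosition_shiftedDegrees_iff.2 ⟨e, hv⟩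

end LeadingPosition

/-! ### Simple transformations. -/

section Transformation

variable {K : Type*} [Field K] [MulSemiringAction (Multiplicative ℕ) K]

theorem smul_eq_zero_iff_of_field (g : Multiplicative ℕ) (a : K) : g • a = 0 ↔ a = 0 :=
  map_eq_zero (MulSemiringAction.toRingHom (Multiplicative ℕ) K g)

theorem add_single_zero_apply {ℓ : ℕ} (u : Fin (ℓ + 1) → ℕ) (c : Fin (ℓ + 1)) :
    (u + Pi.single 0 1 : Fin (ℓ + 1) → ℕ) c = u c + if c = 0 then 1 else 0 := by
  simp [Pi.single_apply]

/-- A simple transformation at position `0` moves the leading position, for the shift increased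
at position `0`, to the larger one of the two previous leading positions. -/
theorem IsLead.reduce {ℓ : ℕ} {u : Fin (ℓ + 1) → ℕ} {p q r : Fin (ℓ + 1) → List K}
    {hp hq : Fin (ℓ + 1)} {dp dq β : ℕ} {α : K} (lp : IsLead u p hp dp) (lq : IsLead u q hq dq)
    (hne : hp ≠ hq) (hβ : dq = dp + β) (hα : α ≠ 0)
    (hr : ∀ c a, (r c).getD a 0 = (q c).getD a 0 -
      if β ≤ a then α * (Multiplicative.ofAdd β • (p c).getD (a - β) 0) else 0)
    (htop : ∀ a, a + u 0 = dq → (r 0).getD a 0 = 0) :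
    IsLead (u + Pi.single 0 1) r (max hp hq) dq := by
  -- The new leading position is not `0`, so its shift does not change.
  have hmax : max hp hq ≠ 0 := by
    intro h0
    have h1 : hp ≤ 0 := h0 ▸ le_max_left hp hq
    have h2 : hq ≤ 0 := h0 ▸ le_max_right hp hq
    exact hne ((Fin.le_zero_iff.1 h1).trans (Fin.le_zero_iff.1 h2).symm)
  have hor : ∀ c a, (r c).getD a 0 ≠ 0 → (q c).getD a 0 ≠ 0 ∨
      ∃ b, a = b + β ∧ (p c).getD b 0 ≠ 0 := by
    intro c a ha
    by_contra! hcon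
    apply ha
    rw [hr, hcon.1]
    split_ifs with hb
    · rw [hcon.2 (a - β) (by omega)]
      simp
    · simp
  have hle : ∀ c a, (r c).getD a 0 ≠ 0 → a + u c ≤ dq := by
    intro c a ha
    rcases hor c a ha with h | ⟨b, rfl, h⟩
    · exact lq.le c a h
    · have := lp.le c b h
      omega
  have hlt : ∀ c a, max hp hq < c → (r c).getD a 0 ≠ 0 → a + u c < dq := by
    intro c a hc ha
    rcases hor c a ha with h | ⟨b, rfl, h⟩
    · exact lq.lt c a ((le_max_right _ _).trans_lt hc) h
    · have := lp.lt c b ((le_max_left _ _).trans_lt hc) h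
      omega
  refine ⟨?_, ?_, ?_⟩
  · rw [add_single_zero_apply, if_neg hmax, add_zero]
    -- In column `max hp hq` only one of `q` and `x^β p` reaches degree `dq`, so its top coefficient
    -- cannot cancel.
    rcases lt_or_gt_of_ne hne with h | h
    · rw [max_eq_right h.le]
      obtain ⟨a, ha, hae⟩ := lq.attained
      refine ⟨a, ?_, hae⟩
      rw [hr]
      split_ifs with hb
      · have : (p hq).getD (a - β) 0 = 0 := by
          by_contra hcon
          have := lp.lt hq _ h hcon
          omega
        rwa [this, smul_zero, mul_zero, sub_zero]
      · rwa [sub_zero]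
    · rw [max_eq_left h.le]
      obtain ⟨a, ha, hae⟩ := lp.attained
      refine ⟨a + β, ?_, by omega⟩
      have : (q hp).getD (a + β) 0 = 0 := by
        by_contra hcon
        have := lq.lt hp _ h hcon
        omega
      rw [hr, this, if_pos (Nat.le_add_left _ _), Nat.add_sub_cancel, zero_sub, neg_ne_zero]
      exact mul_ne_zero hα fun h0 => ha ((smul_eq_zero_iff_of_field _ _).1 h0)
  · intro c a ha
    rw [add_single_zero_apply]
    have := hle c a ha
    -- In column `0` the shift grows by one, but the coefficient of shifted degree `dq` is gone by
    -- `htop`; the bound `dq` survives.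
    split_ifs with hc
    · subst hc
      have : a + u 0 ≠ dq := fun h => ha (htop a h)
      omega
    · omega
  · intro c a hc ha
    rw [add_single_zero_apply, if_neg (fun h => absurd hc (by simp [h]))]
    exact hlt c a hc ha

variable [DecidableEq K]

theorem simpleTransformation_val {ℓ : ℕ} (i j h : Fin (ℓ + 1)) (V : PolyMatrix K ℓ) {a b : ℕ}
    (ha : deg (fieldOps K) (V i h) = a) (hb : deg (fieldOps K) (V j h) = b) :
    (simpleTransformation (fieldOps K) i j h V).val = Function.update V j fun c =>
      (subMonomialMul (fieldOps K)
        ((V j h).getD b 0 / (Multiplicative.ofAdd (b - a) • (V i h).getD a 0)) (b - a)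
        (V i c) (V j c)).val := by
  simp [simpleTransformation, leadingCoeff, ha, hb, Counted.pi]

theorem simpleTransformation_ops {ℓ : ℕ} (i j h : Fin (ℓ + 1)) (V : PolyMatrix K ℓ) :
    (simpleTransformation (fieldOps K) i j h V).ops = 2 + 3 * ∑ c, nnz (V i c) := by
  simp [simpleTransformation, Counted.pi, subMonomialMul_ops, Finset.mul_sum, ← add_assoc]

theorem rowSpace_update {ℓ : ℕ} {i j : Fin (ℓ + 1)} (hij : i ≠ j) (V : PolyMatrix K ℓ)
    (α : K) (β : ℕ) :
    rowSpace (toMatrix (Function.update V j fun c =>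
      (subMonomialMul (fieldOps K) α β (V i c) (V j c)).val)) = rowSpace (toMatrix V) := by
  rw [rowSpace, rowSpace,
    ← Submodule.span_range_update_sub_smul hij (toMatrix V) (SkewPolynomial.monomial β α)]
  congr 2
  funext k
  by_cases hk : k = j
  · subst hk
    funext c
    simp [toMatrix, toSkew_subMonomialMul]
  · funext c
    simp [toMatrix, hk]

/-- The effect of a simple transformation at position `0` on rows whose shifted degrees are
attained both at their leading positions and at position `0`. -/
theorem simpleTransformation_spec {ℓ : ℕ} {u : Fin (ℓ + 1) → ℕ} {V : PolyMatrix K ℓ}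
    {i j hi hj : Fin (ℓ + 1)} {di dj : ℕ} (li : IsLead u (V i) hi di) (ti : HasTop u (V i) di)
    (lj : IsLead u (V j) hj dj) (tj : HasTop u (V j) dj) (hne : hi ≠ hj) (hij : i ≠ j)
    (hd : di ≤ dj) :
    ∃ r : Fin (ℓ + 1) → List K,
      (simpleTransformation (fieldOps K) i j 0 V).val = Function.update V j r ∧
      IsLead (u + Pi.single 0 1) r (max hi hj) dj ∧
      (∀ c a, (r c).getD a 0 ≠ 0 →
        (∃ b, (V i c).getD b 0 ≠ 0) ∨ ∃ b, (V j c).getD b 0 ≠ 0) ∧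
      rowSpace (toMatrix (simpleTransformation (fieldOps K) i j 0 V).val) =
        rowSpace (toMatrix V) := by
  obtain ⟨a, ha, hai⟩ := ti
  obtain ⟨b, hb, hbj⟩ := tj
  have hda : deg (fieldOps K) (V i 0) = a := deg_eq_coe_iff.2
    ⟨ha, fun m hm => by have := li.le 0 m hm; omega⟩
  have hdb : deg (fieldOps K) (V j 0) = b := deg_eq_coe_iff.2
    ⟨hb, fun m hm => by have := lj.le 0 m hm; omega⟩
  have hval := simpleTransformation_val i j 0 V hda hdb
  have hθ : Multiplicative.ofAdd (b - a) • (V i 0).getD a 0 ≠ 0 :=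
    fun h => ha ((smul_eq_zero_iff_of_field _ _).1 h)
  refine ⟨_, hval, ?_, ?_, ?_⟩
  · refine li.reduce lj hne (β := b - a) (by omega) (div_ne_zero hb hθ)
      (fun c m => subMonomialMul_getD _ _ _ _ _) fun m hm => ?_
    obtain rfl : m = b := by omega
    rw [subMonomialMul_getD, if_pos (Nat.sub_le _ _), show m - (m - a) = a by omega,
      div_mul_cancel₀ _ hθ, sub_self]
  · intro c m hm
    rw [subMonomialMul_getD] at hm
    by_contra! hcon
    apply hm
    rw [hcon.2, hcon.1]
    simp
  · rw [hval, rowSpace_update hij]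

end Transformation

/-! ### One sweep over the rows whose leading position becomes `0`. -/

section Sweep

variable {K : Type*} [Field K]

/-- All columns other than column `0` and the columns in `T` are zero off the diagonal. -/
def SupportedOn {ℓ : ℕ} (V : PolyMatrix K ℓ) (T : Finset (Fin (ℓ + 1))) : Prop :=
  ∀ i c a, (V i c).getD a 0 ≠ 0 → c = 0 ∨ c = i ∨ c ∈ T

/-- Invariant of the sweep of one step of the weak Popov walk: `t` is the pivot, `is` lists the
rows still to be treated; `g` holds the leading positions (for the shift `u` if the row is still
to be treated, for the increased shift if it is finished), `d` the `u`-shifted degrees. -/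
structure SweepState {ℓ : ℕ} (u : Fin (ℓ + 1) → ℕ) (d : Fin (ℓ + 1) → ℕ) (N : ℕ)
    (is : List (Fin (ℓ + 1))) (t : Fin (ℓ + 1)) (V : PolyMatrix K ℓ)
    (g : Fin (ℓ + 1) → Fin (ℓ + 1)) (T : Finset (Fin (ℓ + 1))) : Prop where
  nodup : (t :: is).Nodup
  inj : Function.Injective g
  g_pivot : g t = 0
  finished : ∀ j, j ≠ t → j ∉ is → IsLead (u + Pi.single 0 1) (V j) (g j) (d j)
  pending : ∀ j ∈ is, IsLead u (V j) (g j) (d j)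
  pending_top : ∀ j ∈ is, HasTop u (V j) (d j)
  pivot : ∃ p, IsLead u (V t) p (d t) ∧ ∀ j ∈ is, p < g j
  pivot_top : HasTop u (V t) (d t)
  sorted : is.Pairwise fun i j => g i < g j
  supported : SupportedOn V T
  pivot_mem : t = 0 ∨ t ∈ T
  card_le : T.card + d t ≤ N + u 0

/-- A bound for the cost of subtracting a multiple of a row of `u`-shifted degree at most `e`. -/
def rowCost {ℓ : ℕ} (u : Fin (ℓ + 1) → ℕ) (N e : ℕ) : ℕ :=
  2 + 3 * (e + 1 + N + ∑ c, if c = 0 then 0 else e - u c)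

section Cost

variable [DecidableEq K]

/-- Column `c` holds at most `e - u c + 1` non-zero coefficients. The extra `1` is charged only to
columns in `T`, at most `N` of them; the parts `e - u c` are summed over all columns other than `0`,
which makes the bound independent of `T`. -/
theorem sum_nnz_le {ℓ : ℕ} {u : Fin (ℓ + 1) → ℕ} {v : Fin (ℓ + 1) → List K} {N e : ℕ}
    {T : Finset (Fin (ℓ + 1))} (hle : ∀ c a, (v c).getD a 0 ≠ 0 → a + u c ≤ e)
    (hT : ∀ c a, (v c).getD a 0 ≠ 0 → c = 0 ∨ c ∈ T) (hcard : T.card ≤ N) :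
    2 + 3 * ∑ c, nnz (v c) ≤ rowCost u N e := by
  have h1 : ∀ c, nnz (v c) ≤ (if c = 0 then e + 1 else 0) + (if c ∈ T then 1 else 0) +
      if c = 0 then 0 else e - u c := by
    intro c
    by_cases hc : c = 0
    · have : nnz (v c) ≤ e + 1 := nnz_le_of_forall_lt fun a ha => by
        have := hle c a ha
        omega
      simp only [hc, if_true] at this ⊢
      omega
    · by_cases hcT : c ∈ T
      · have : nnz (v c) ≤ e - u c + 1 := nnz_le_of_forall_lt fun a ha => by
          have := hle c a ha
          omega
        simp only [hc, hcT, if_true, if_false]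
        omega
      · have : nnz (v c) = 0 := nnz_eq_zero_of_forall fun a => by
          by_contra ha
          rcases hT c a ha with h | h
          · exact hc h
          · exact hcT h
        omega
  have h2 := Finset.sum_le_sum fun c (_ : c ∈ Finset.univ) => h1 c
  rw [Finset.sum_add_distrib, Finset.sum_add_distrib] at h2
  simp only [Finset.sum_ite_eq', Finset.mem_univ, if_true, Finset.sum_ite_mem,
    Finset.univ_inter, Finset.sum_const, smul_eq_mul, mul_one] at h2
  unfold rowCost
  omega

end Cost

variable [DecidableEq K] [MulSemiringAction (Multiplicative ℕ) K] {ℓ : ℕ} {u : Fin (ℓ + 1) → ℕ}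
  {d : Fin (ℓ + 1) → ℕ} {N : ℕ} {is : List (Fin (ℓ + 1))} {i t : Fin (ℓ + 1)}
  {V : PolyMatrix K ℓ} {g : Fin (ℓ + 1) → Fin (ℓ + 1)} {T : Finset (Fin (ℓ + 1))}

/-- The algorithm compares degrees in column `0`; since both shifted degrees are attained there,
this compares the shifted degrees of the rows. -/
theorem HasTop.deg_le_deg_iff {v w : Fin (ℓ + 1) → List K} {dv dw : ℕ} {hv hw : Fin (ℓ + 1)}
    (lv : IsLead u v hv dv) (tv : HasTop u v dv) (lw : IsLead u w hw dw) (tw : HasTop u w dw) :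
    deg (fieldOps K) (v 0) ≤ deg (fieldOps K) (w 0) ↔ dv ≤ dw := by
  obtain ⟨a, ha, hae⟩ := tv
  obtain ⟨b, hb, hbe⟩ := tw
  rw [deg_eq_coe_iff.2 ⟨ha, fun m hm => by have := lv.le 0 m hm; omega⟩,
    deg_eq_coe_iff.2 ⟨hb, fun m hm => by have := lw.le 0 m hm; omega⟩, Nat.cast_le]
  omega

/-- The pivot stays. Row `i` keeps its position because the pivot's is smaller, and no new column
fills up: the non-zero columns of the pivot row lie in `T` or are `0`, its diagonal column included.
-/
theorem SweepState.reduce_next (h : SweepState u d N (i :: is) t V g T) (hd : d t ≤ d i) :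
    SweepState u d N is t (simpleTransformation (fieldOps K) t i 0 V).val g T ∧
      rowSpace (toMatrix (simpleTransformation (fieldOps K) t i 0 V).val) =
        rowSpace (toMatrix V) ∧
      (simpleTransformation (fieldOps K) t i 0 V).ops ≤ rowCost u N (d i) := by
  obtain ⟨p, lp, hp⟩ := h.pivot
  have hnd := h.nodup
  have hsort := h.sorted
  simp only [List.nodup_cons, List.mem_cons, not_or, List.pairwise_cons] at hnd hsort
  have hpi := hp i List.mem_cons_self
  obtain ⟨r, hr, lr, hcol, hrow⟩ := simpleTransformation_spec lp h.pivot_top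
    (h.pending i List.mem_cons_self) (h.pending_top i List.mem_cons_self) hpi.ne hnd.1.1 hd
  rw [max_eq_right hpi.le] at lr
  refine ⟨?_, hrow, ?_⟩
  · rw [hr]
    have hne : ∀ j ∈ is, j ≠ i := fun j hj hji => hnd.2.1 (hji ▸ hj)
    refine ⟨?_, h.inj, h.g_pivot, ?_, ?_, ?_, ?_, ?_, hsort.2, ?_, h.pivot_mem, h.card_le⟩
    · simp only [List.nodup_cons]
      exact ⟨hnd.1.2, hnd.2.2⟩
    · intro j hjt hj
      by_cases hji : j = i
      · subst hji
        rwa [Function.update_self]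
      · rw [Function.update_of_ne hji]
        exact h.finished j hjt (by simp [hji, hj])
    · intro j hj
      rw [Function.update_of_ne (hne j hj)]
      exact h.pending j (List.mem_cons_of_mem _ hj)
    · intro j hj
      rw [Function.update_of_ne (hne j hj)]
      exact h.pending_top j (List.mem_cons_of_mem _ hj)
    · rw [Function.update_of_ne hnd.1.1]
      exact ⟨p, lp, fun j hj => hp j (List.mem_cons_of_mem _ hj)⟩
    · rw [Function.update_of_ne hnd.1.1]
      exact h.pivot_top
    · intro j c a hja
      by_cases hji : j = i
      · subst hji
        rw [Function.update_self] at hja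
        rcases hcol c a hja with ⟨b, hb⟩ | ⟨b, hb⟩
        · rcases h.supported t c b hb with h1 | rfl | h1
          · exact Or.inl h1
          · exact h.pivot_mem.imp_right Or.inr
          · exact Or.inr (Or.inr h1)
        · exact h.supported j c b hb
      · rw [Function.update_of_ne hji] at hja
        exact h.supported j c a hja
  · rw [simpleTransformation_ops]
    refine sum_nnz_le (T := T) (fun c a ha => (lp.le c a ha).trans hd) (fun c a ha => ?_) ?_
    · rcases h.supported t c a ha with h1 | rfl | h1
      · exact Or.inl h1
      · exact h.pivot_mem
      · exact Or.inr h1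
    -- The pivot degree is attained in column `0`, so it is at least `u 0`, and `card_le` leaves at
    -- most `N` elements for `T`.
    · obtain ⟨a, -, ha⟩ := h.pivot_top
      have := h.card_le
      omega

/-- The old pivot inherits the position of row `i`, and row `i` takes over the value `0`; hence the
swap. The diagonal column of row `i` may now fill up in row `t`, so `i` joins `T`; the strict drop
`d i < d t` pays for it. -/
theorem SweepState.reduce_pivot (h : SweepState u d N (i :: is) t V g T) (hd : d i < d t) :
    SweepState u d N is i (simpleTransformation (fieldOps K) i t 0 V).val
      (g ∘ Equiv.swap t i) (insert i T) ∧
      rowSpace (toMatrix (simpleTransformation (fieldOps K) i t 0 V).val) =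
        rowSpace (toMatrix V) ∧
      (simpleTransformation (fieldOps K) i t 0 V).ops ≤ rowCost u N (d i) := by
  obtain ⟨p, lp, hp⟩ := h.pivot
  have hnd := h.nodup
  have hsort := h.sorted
  simp only [List.nodup_cons, List.mem_cons, not_or, List.pairwise_cons] at hnd hsort
  have hpi := hp i List.mem_cons_self
  have li := h.pending i List.mem_cons_self
  have ti := h.pending_top i List.mem_cons_self
  obtain ⟨r, hr, lr, hcol, hrow⟩ := simpleTransformation_spec li ti
    lp h.pivot_top hpi.ne' (Ne.symm hnd.1.1) hd.le
  rw [max_eq_left hpi.le] at lr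
  have hcard : (insert i T).card + d i ≤ N + u 0 := by
    have := h.card_le
    have := Finset.card_insert_le i T
    omega
  refine ⟨?_, hrow, ?_⟩
  · rw [hr]
    have hne : ∀ j ∈ is, j ≠ i := fun j hj hji => hnd.2.1 (hji ▸ hj)
    have hnt : ∀ j ∈ is, j ≠ t := fun j hj hji => hnd.1.2 (hji ▸ hj)
    have hg : ∀ j, j ≠ t → j ≠ i → (g ∘ Equiv.swap t i) j = g j := fun j h1 h2 => by
      rw [Function.comp_apply, Equiv.swap_apply_of_ne_of_ne h1 h2]
    refine ⟨?_, h.inj.comp (Equiv.injective _), ?_, ?_, ?_, ?_, ?_, ?_, ?_, ?_,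
      Or.inr (Finset.mem_insert_self _ _), hcard⟩
    · simp only [List.nodup_cons]
      exact hnd.2
    · simpa using h.g_pivot
    · intro j hji hj
      by_cases hjt : j = t
      · subst hjt
        rw [Function.update_self, Function.comp_apply, Equiv.swap_apply_left]
        exact lr
      · rw [Function.update_of_ne hjt, hg j hjt hji]
        exact h.finished j hjt (by simp [hji, hj])
    · intro j hj
      rw [Function.update_of_ne (hnt j hj), hg j (hnt j hj) (hne j hj)]
      exact h.pending j (List.mem_cons_of_mem _ hj)
    · intro j hj
      rw [Function.update_of_ne (hnt j hj)]
      exact h.pending_top j (List.mem_cons_of_mem _ hj)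
    · rw [Function.update_of_ne (Ne.symm hnd.1.1)]
      refine ⟨g i, li, fun j hj => ?_⟩
      rw [hg j (hnt j hj) (hne j hj)]
      exact hsort.1 j hj
    · rw [Function.update_of_ne (Ne.symm hnd.1.1)]
      exact ti
    · refine hsort.2.imp_of_mem fun {a b} ha hb hab => ?_
      rwa [hg a (hnt a ha) (hne a ha), hg b (hnt b hb) (hne b hb)]
    · intro j c a hja
      simp only [Finset.mem_insert]
      by_cases hjt : j = t
      · subst hjt
        rw [Function.update_self] at hja
        rcases hcol c a hja with ⟨b, hb⟩ | ⟨b, hb⟩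
        · have := h.supported i c b hb
          tauto
        · have := h.supported j c b hb
          tauto
      · rw [Function.update_of_ne hjt] at hja
        have := h.supported j c a hja
        tauto
  · rw [simpleTransformation_ops]
    refine sum_nnz_le (T := insert i T) li.le (fun c a ha => ?_) ?_
    · rw [Finset.mem_insert]
      exact h.supported i c a ha
    · obtain ⟨a, -, ha⟩ := ti
      omega

/-- Each pending row is charged once, at its own degree, whichever of the two rows is subtracted:
the subtracted one never has the larger degree. -/
theorem SweepState.sweep (h : SweepState u d N is t V g T) :
    ∃ t' g' T', SweepState u d N [] t' (sweep (fieldOps K) t is V).val g' T' ∧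
      rowSpace (toMatrix (sweep (fieldOps K) t is V).val) = rowSpace (toMatrix V) ∧
      (SkewWalk.sweep (fieldOps K) t is V).ops ≤ (is.map fun i => rowCost u N (d i)).sum := by
  induction is generalizing t V g T with
  | nil => exact ⟨t, g, T, h, rfl, le_rfl⟩
  | cons i is ih =>
    obtain ⟨p, lp, -⟩ := h.pivot
    have hiff := HasTop.deg_le_deg_iff lp h.pivot_top (h.pending i List.mem_cons_self)
      (h.pending_top i List.mem_cons_self)
    by_cases hd : d t ≤ d i
    · obtain ⟨h1, h2, h3⟩ := h.reduce_next hd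
      obtain ⟨t', g', T', h4, h5, h6⟩ := ih h1
      rw [SkewWalk.sweep, if_pos (hiff.2 hd)]
      refine ⟨t', g', T', h4, h5.trans h2, ?_⟩
      rw [Counted.bind_ops, List.map_cons, List.sum_cons]
      exact Nat.add_le_add h3 h6
    · obtain ⟨h1, h2, h3⟩ := h.reduce_pivot (not_le.1 hd)
      obtain ⟨t', g', T', h4, h5, h6⟩ := ih h1
      rw [SkewWalk.sweep, if_neg (mt hiff.1 hd)]
      refine ⟨t', g', T', h4, h5.trans h2, ?_⟩
      rw [Counted.bind_ops, List.map_cons, List.sum_cons]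
      exact Nat.add_le_add h3 h6

end Sweep

/-! ### Successive steps of the walk. -/

section Walk

variable {K : Type*} [Field K] {ℓ : ℕ}

theorem IsLead.of_hasTop {u : Fin (ℓ + 1) → ℕ} {v : Fin (ℓ + 1) → List K} {p : Fin (ℓ + 1)}
    {e : ℕ} (hv : IsLead u v p e) (ht : HasTop u v e) : IsLead (u + Pi.single 0 1) v 0 (e + 1) := by
  obtain ⟨a, ha, hae⟩ := ht
  refine ⟨⟨a, ha, by rw [add_single_zero_apply, if_pos rfl]; omega⟩, fun c b hb => ?_,
    fun c b hc hb => ?_⟩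
  · have := hv.le c b hb
    rw [add_single_zero_apply]
    split_ifs <;> omega
  · have := hv.le c b hb
    rw [add_single_zero_apply, if_neg hc.ne']
    omega

/-- Increasing the shift at position `0` keeps the leading position or moves it to `0`, and in the
latter case the shifted degree is attained at position `0`. -/
theorem IsLead.shift_or {u : Fin (ℓ + 1) → ℕ} {v : Fin (ℓ + 1) → List K} {h : Fin (ℓ + 1)}
    {e : ℕ} (hv : IsLead u v h e) :
    (h ≠ 0 ∧ IsLead (u + Pi.single 0 1) v h e) ∨ HasTop u v e := by
  by_cases ht : HasTop u v e
  · exact Or.inr ht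
  · have hlt : ∀ a, (v 0).getD a 0 ≠ 0 → a + u 0 < e := fun a ha =>
      lt_of_le_of_ne (hv.le 0 a ha) fun hae => ht ⟨a, ha, hae⟩
    have h0 : h ≠ 0 := by
      rintro rfl
      exact ht hv.attained
    refine Or.inl ⟨h0, ?_, fun c a ha => ?_, fun c a hc ha => ?_⟩
    · rw [add_single_zero_apply, if_neg h0, add_zero]
      exact hv.attained
    · rw [add_single_zero_apply]
      have := hv.le c a ha
      split_ifs with hc
      · subst hc
        exact hlt a ha
      · exact this
    · rw [add_single_zero_apply, if_neg (fun h' => absurd hc (by simp [h']))]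
      exact hv.lt c a hc ha

/-- Invariant of the weak Popov walk: the rows have pairwise different leading positions `g`;
their degrees `d` satisfy the degree bound, and so does the pivot row `t` at position `0`. -/
structure WalkState (u : Fin (ℓ + 1) → ℕ) (N : ℕ) (V : PolyMatrix K ℓ)
    (g : Fin (ℓ + 1) → Fin (ℓ + 1)) (d : Fin (ℓ + 1) → ℕ) (t : Fin (ℓ + 1))
    (T : Finset (Fin (ℓ + 1))) : Prop where
  inj : Function.Injective g
  g_pivot : g t = 0
  lead : ∀ j, IsLead u (V j) (g j) (d j)
  supported : SupportedOn V T
  pivot_mem : t = 0 ∨ t ∈ T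
  card_le : T.card + d t ≤ N + u 0
  sum_le : ∑ j, d j ≤ N + ∑ c, u c

variable [DecidableEq K] [MulSemiringAction (Multiplicative ℕ) K] {u : Fin (ℓ + 1) → ℕ} {N : ℕ}
  {V : PolyMatrix K ℓ} {g : Fin (ℓ + 1) → Fin (ℓ + 1)} {d : Fin (ℓ + 1) → ℕ} {t : Fin (ℓ + 1)}
  {T : Finset (Fin (ℓ + 1))}

theorem IsLead.leadingPosition_shift_eq_zero_iff {v : Fin (ℓ + 1) → List K} {h : Fin (ℓ + 1)}
    {e : ℕ} (hv : IsLead u v h e) :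
    SkewWalk.leadingPosition (shiftedDegrees (fieldOps K) (u + Pi.single 0 1) v) =
      ((0 : Fin (ℓ + 1)) : WithBot _) ↔ HasTop u v e := by
  constructor
  · intro h0
    rcases hv.shift_or with ⟨h1, h2⟩ | h1
    · rw [h2.leadingPosition] at h0
      exact absurd (WithBot.coe_injective h0) h1
    · exact h1
  · intro ht
    exact (hv.of_hasTop ht).leadingPosition

/-- The row with leading position `0` is always among those listed and comes first after sorting, so
the pivot `t` of the invariant is the pivot with which the sweep starts. -/
theorem WalkState.exists_sorted (h : WalkState u N V g d t T) :
    ∃ is : List (Fin (ℓ + 1)),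
      (t :: is).Nodup ∧ (t :: is).Pairwise (fun i j => g i < g j) ∧
      (∀ j, j ∈ t :: is ↔ HasTop u (V j) (d j)) ∧
      weakPopovWalk (fieldOps K) V u = sweep (fieldOps K) t is V := by
  have hg : ∀ i, leadingPosition (shiftedDegrees (fieldOps K) u (V i)) = (g i : WithBot _) :=
    fun i => (h.lead i).leadingPosition
  unfold weakPopovWalk
  simp only [hg]
  set L := (List.finRange (ℓ + 1)).filter fun i =>
    leadingPosition (shiftedDegrees (fieldOps K) (u + Pi.single 0 1) (V i)) =
      ((0 : Fin (ℓ + 1)) : WithBot _) with hL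
  let r : Fin (ℓ + 1) → Fin (ℓ + 1) → Prop := fun i j => (g i : WithBot (Fin (ℓ + 1))) ≤ g j
  have : Std.Total r := ⟨fun i j => le_total (g i : WithBot (Fin (ℓ + 1))) (g j)⟩
  have : IsTrans (Fin (ℓ + 1)) r :=
    ⟨fun i j k => le_trans (a := (g i : WithBot (Fin (ℓ + 1)))) (b := g j) (c := g k)⟩
  have hperm := List.perm_insertionSort
    (fun i j => (g i : WithBot (Fin (ℓ + 1))) ≤ g j) L
  have hsort : (L.insertionSort r).Pairwise r := List.pairwise_insertionSort r L
  change (List.insertionSort (fun i j => (g i : WithBot (Fin (ℓ + 1))) ≤ g j) L).Pairwise r at hsort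
  generalize List.insertionSort (fun i j => (g i : WithBot (Fin (ℓ + 1))) ≤ g j) L = L'
    at hperm hsort
  have hmem : ∀ j, j ∈ L' ↔ HasTop u (V j) (d j) := fun j => by
    rw [hperm.mem_iff, hL, List.mem_filter, decide_eq_true_eq,
      (h.lead j).leadingPosition_shift_eq_zero_iff]
    simp
  have hnd : L'.Nodup := hperm.nodup_iff.2 ((List.nodup_finRange _).filter _)
  have ht : t ∈ L' := by
    rw [hmem]
    have := (h.lead t).attained
    rwa [h.g_pivot] at this
  cases L' with
  | nil => cases ht
  | cons s is =>
    have hst : s = t := by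
      rcases List.mem_cons.1 ht with h1 | h1
      · exact h1.symm
      · have h2 : g s ≤ g t := WithBot.coe_le_coe.1 ((List.pairwise_cons.1 hsort).1 t h1)
        rw [h.g_pivot, Fin.le_zero_iff] at h2
        exact h.inj (h2.trans h.g_pivot.symm)
    subst hst
    refine ⟨is, hnd, ?_, hmem, rfl⟩
    refine (hsort.and hnd).imp fun {i j} hij => ?_
    exact lt_of_le_of_ne (WithBot.coe_le_coe.1 hij.1) fun he => hij.2 (h.inj he)

/-- Only the last pivot gains degree, by exactly the one unit that `u 0` gains; both degree bounds
of the invariant therefore persist. -/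
theorem WalkState.step (h : WalkState u N V g d t T) :
    ∃ g' d' t' T',
      WalkState (u + Pi.single 0 1) N (weakPopovWalk (fieldOps K) V u).val g' d' t' T' ∧
      rowSpace (toMatrix (weakPopovWalk (fieldOps K) V u).val) = rowSpace (toMatrix V) ∧
      (weakPopovWalk (fieldOps K) V u).ops ≤ ∑ j ∈ Finset.univ.erase t, rowCost u N (d j) := by
  obtain ⟨is, hnd, hsort, hmem, heq⟩ := h.exists_sorted
  rw [heq]
  have hsort' := List.pairwise_cons.1 hsort
  have hs : SweepState u d N is t V g T := by
    refine ⟨hnd, h.inj, h.g_pivot, fun j hjt hj => ?_, fun j _ => h.lead j,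
      fun j hj => (hmem j).1 (List.mem_cons_of_mem _ hj), ⟨g t, h.lead t, hsort'.1⟩,
      (hmem t).1 List.mem_cons_self, hsort'.2, h.supported, h.pivot_mem, h.card_le⟩
    rcases (h.lead j).shift_or with h1 | h1
    · exact h1.2
    · exact absurd ((hmem j).2 h1) (by simp [hjt, hj])
  obtain ⟨t', g', T', h1, h2, h3⟩ := hs.sweep
  refine ⟨g', d + Pi.single t' 1, t', T', ?_, h2, h3.trans ?_⟩
  · refine ⟨h1.inj, h1.g_pivot, fun j => ?_, h1.supported, h1.pivot_mem, ?_, ?_⟩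
    · by_cases hj : j = t'
      · subst hj
        obtain ⟨p, hp, -⟩ := h1.pivot
        simpa [h1.g_pivot] using hp.of_hasTop h1.pivot_top
      · simpa [hj] using h1.finished j hj (by simp)
    · have := h1.card_le
      simp only [Pi.add_apply, Pi.single_eq_same]
      omega
    · have := h.sum_le
      simp only [Pi.add_apply, Finset.sum_add_distrib, Finset.sum_pi_single', Finset.mem_univ,
        if_true]
      omega
  · have hnd' := List.nodup_cons.1 hnd
    rw [← List.sum_toFinset _ hnd'.2]
    refine Finset.sum_le_sum_of_subset fun j hj => ?_
    rw [List.mem_toFinset] at hj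
    exact Finset.mem_erase.2 ⟨fun hjt => hnd'.1 (hjt ▸ hj), Finset.mem_univ _⟩

end Walk

/-! ### Cost of a step and of the whole walk. -/

section Cost

/-- The spread of the shift: the sum is largest at `h = ℓ`, where it is `0 + 1 + ⋯ + ℓ`. -/
theorem sum_fin_sub (ℓ h : ℕ) (hh : h ≤ ℓ) : ∑ c : Fin (ℓ + 1), (h - c) ≤ (ℓ + 1).choose 2 := by
  rw [Fin.sum_univ_eq_sum_range (fun c => h - c) (ℓ + 1), Nat.choose_two_right,
    ← Finset.sum_range_id, ← Finset.sum_range_reflect]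
  refine Finset.sum_le_sum fun c _ => ?_
  omega

end Cost

section WalkCost

variable {K : Type*} [Field K] {ℓ : ℕ} {u : Fin (ℓ + 1) → ℕ} {N : ℕ}
  {V : PolyMatrix K ℓ} {g : Fin (ℓ + 1) → Fin (ℓ + 1)} {d : Fin (ℓ + 1) → ℕ} {t : Fin (ℓ + 1)}
  {T : Finset (Fin (ℓ + 1))}

theorem mul_pred_le {ℓ k n : ℕ} (hk : (ℓ + 1).choose 2 * (k - 1) < n) :
    ℓ * (k - 1) ≤ n := by
  refine le_trans (Nat.mul_le_mul_right _ ?_) hk.le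
  rw [Nat.choose_succ_succ' ℓ 1, Nat.choose_one_right]
  exact Nat.le_add_right _ _

/-- Here `δ` is the excess of the row's degree over the shift at its leading position `h`. Column
`c` then contributes at most `δ + (h - c) (k - 1)`, and the second terms sum to less than `n` by
`hk`. -/
theorem rowCost_le {k n δ h : ℕ} (hk : (ℓ + 1).choose 2 * (k - 1) < n)
    (hu : ∀ c, c ≠ 0 → u c = n + c * (k - 1)) (hh : h ≤ ℓ) :
    rowCost u n (δ + (n + h * (k - 1))) ≤ 5 + 12 * n + 3 * (ℓ + 2) * δ := by
  have h1 : h * (k - 1) ≤ n := (Nat.mul_le_mul_right _ hh).trans (mul_pred_le hk)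
  have h2 : ∀ c : Fin (ℓ + 1), (if c = 0 then 0 else δ + (n + h * (k - 1)) - u c) ≤
      δ + (h - c) * (k - 1) := by
    intro c
    split_ifs with hc
    · exact Nat.zero_le _
    · rw [hu c hc, Nat.sub_mul]
      omega
  have h3 := Finset.sum_le_sum fun c (_ : c ∈ Finset.univ) => h2 c
  rw [Finset.sum_add_distrib, ← Finset.sum_mul] at h3
  have h4 := Nat.mul_le_mul_right (k - 1) (sum_fin_sub ℓ h hh)
  simp only [Finset.sum_const, Finset.card_univ, Fintype.card_fin, smul_eq_mul] at h3
  unfold rowCost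
  have h5 : 3 * (ℓ + 2) * δ = 3 * ((ℓ + 1) * δ) + 3 * δ := by ring
  omega

/-- As `g` is a permutation, the shifts at the leading positions sum to `∑ u`, so the excesses sum
to at most `n`. The pivot is left out: its position `0` is the one where `hu` says nothing. -/
theorem WalkState.sum_rowCost_le {k n : ℕ} (h : WalkState u n V g d t T) (hℓ : 0 < ℓ)
    (hk : (ℓ + 1).choose 2 * (k - 1) < n) (hu : ∀ c, c ≠ 0 → u c = n + c * (k - 1)) :
    ∑ j ∈ Finset.univ.erase t, rowCost u n (d j) ≤ 26 * (ℓ * n) := by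
  have hge : ∀ j, u (g j) ≤ d j := fun j => by
    obtain ⟨a, -, ha⟩ := (h.lead j).attained
    omega
  have hbij : Function.Bijective g := Finite.injective_iff_bijective.1 h.inj
  have hδ : ∑ j, (d j - u (g j)) ≤ n := by
    have h1 : ∑ j, (d j - u (g j)) + ∑ j, u (g j) = ∑ j, d j := by
      rw [← Finset.sum_add_distrib]
      exact Finset.sum_congr rfl fun j _ => Nat.sub_add_cancel (hge j)
    have h2 : ∑ j, u (g j) = ∑ j, u j := hbij.sum_comp u
    have := h.sum_le
    omega
  have h1 : ∀ j ∈ Finset.univ.erase t, rowCost u n (d j) ≤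
      5 + 12 * n + 3 * (ℓ + 2) * (d j - u (g j)) := by
    intro j hj
    have hg : g j ≠ 0 := fun h0 => (Finset.mem_erase.1 hj).1 (h.inj (h0.trans h.g_pivot.symm))
    refine le_trans (le_of_eq ?_)
      (rowCost_le (δ := d j - u (g j)) hk hu (Nat.lt_succ_iff.1 (g j).isLt))
    rw [← hu _ hg, Nat.sub_add_cancel (hge j)]
  have h2 := Finset.sum_le_sum h1
  rw [Finset.sum_add_distrib, ← Finset.mul_sum, Finset.sum_const, Finset.card_erase_of_mem
    (Finset.mem_univ _), Finset.card_univ, Fintype.card_fin, Nat.add_sub_cancel, smul_eq_mul] at h2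
  have h3 : ∑ j ∈ Finset.univ.erase t, (d j - u (g j)) ≤ n :=
    (Finset.sum_le_sum_of_subset (Finset.erase_subset _ _)).trans hδ
  have h4 := Nat.mul_le_mul_left (3 * (ℓ + 2)) h3
  have hn : 0 < n := by omega
  refine h2.trans ((Nat.add_le_add_left h4 _).trans ?_)
  -- The bound is `ℓ (5 + 12 n) + 3 (ℓ + 2) n`, and `5 + 12 + 3 + 6 = 26` as `ℓ, n ≥ 1`.
  nlinarith

variable [DecidableEq K] [MulSemiringAction (Multiplicative ℕ) K]

theorem WalkState.walkSteps {k n : ℕ} (hℓ : 0 < ℓ)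
    (hk : (ℓ + 1).choose 2 * (k - 1) < n) (m : ℕ) (h : WalkState u n V g d t T)
    (hu : ∀ c, c ≠ 0 → u c = n + c * (k - 1)) :
    ∃ g' d' t' T',
      WalkState (u + Pi.single 0 m) n (walkSteps (fieldOps K) m u V).val g' d' t' T' ∧
      rowSpace (toMatrix (SkewWalk.walkSteps (fieldOps K) m u V).val) = rowSpace (toMatrix V) ∧
      (SkewWalk.walkSteps (fieldOps K) m u V).ops ≤ m * (26 * (ℓ * n)) := by
  induction m generalizing u V g d t T with
  | zero => exact ⟨g, d, t, T, by simpa [SkewWalk.walkSteps] using h, rfl, Nat.zero_le _⟩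
  | succ m ih =>
    obtain ⟨g', d', t', T', h1, h2, h3⟩ := h.step
    obtain ⟨g₂, d₂, t₂, T₂, h4, h5, h6⟩ := ih h1 fun c hc => by
      rw [add_single_zero_apply, if_neg hc, add_zero, hu c hc]
    refine ⟨g₂, d₂, t₂, T₂, ?_, h5.trans h2, ?_⟩
    · rw [add_assoc, ← Pi.single_add, add_comm 1 m] at h4
      exact h4
    · have := h.sum_rowCost_le hℓ hk hu
      rw [SkewWalk.walkSteps, Counted.bind_ops, Nat.add_mul, one_mul]
      omega

end WalkCost

/-! ### The walk applied to the explicit basis. -/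

section MvWalk

variable {K : Type*} [Field K] {ℓ : ℕ}

theorem toMatrix_coeff {V : PolyMatrix K ℓ} (i c : Fin (ℓ + 1)) (a : ℕ) :
    (toMatrix V i c).coeff a = (V i c).getD a 0 := toSkew_coeff _ _

variable [MulSemiringAction (Multiplicative ℕ) K]

/-- The explicit basis is in weak Popov form for a shift that is large outside position `0`. -/
theorem walkState_mvMatrix {n D : ℕ} {G : SkewPolynomial K} {R : Fin ℓ → SkewPolynomial K}
    {V : PolyMatrix K ℓ} {u : Fin (ℓ + 1) → ℕ} (hV : toMatrix V = mvMatrix G R)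
    (hG : degree G = D) (hD : D ≤ n) (hR : ∀ t, degree (R t) < n) (hu0 : u 0 = 0)
    (hu : ∀ c, c ≠ 0 → n ≤ u c) :
    WalkState u n V id (u + Pi.single 0 D) 0 ∅ := by
  have hG' := degree_eq_coe_iff.1 hG
  have h00 : ∀ a, (V 0 0).getD a 0 = G.coeff a := fun a => by
    rw [← toMatrix_coeff, hV]
    rfl
  have h0s : ∀ c a, c ≠ 0 → (V 0 c).getD a 0 = 0 := fun c a hc => by
    obtain ⟨c, rfl⟩ := Fin.exists_succ_eq.2 hc
    rw [← toMatrix_coeff, hV]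
    rfl
  have hs0 : ∀ t a, (V (Fin.succ t) 0).getD a 0 ≠ 0 → a < n := fun t a ha => by
    rw [← toMatrix_coeff, hV] at ha
    have h1 : (R t).coeff a ≠ 0 := fun h0 => ha <| by
      change (-R t).coeff a = 0
      rw [SkewPolynomial.coeff_neg, h0, neg_zero]
    exact_mod_cast ((degree_le_iff _ _).1 le_rfl a h1).trans_lt (hR t)
  have hss : ∀ (t s : Fin ℓ) a, (V t.succ s.succ).getD a 0 = if s = t ∧ a = 0 then 1 else 0 := by
    intro t s a
    rw [← toMatrix_coeff, hV]
    change SkewPolynomial.coeff (if s = t then 1 else 0) a = _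
    by_cases hst : s = t
    · simp [hst, SkewPolynomial.coeff_one, eq_comm]
    · simp [hst]
  refine ⟨Function.injective_id, rfl, fun j => ?_, fun i c a ha => ?_, Or.inl rfl, ?_, ?_⟩
  · refine Fin.cases ?_ (fun t => ?_) j
    · refine ⟨⟨D, ?_, by simp [hu0]⟩, fun c a ha => ?_, fun c a hc ha => ?_⟩
      · rw [id, h00]
        exact hG'.1
      · by_cases hc : c = 0
        · subst hc
          rw [h00] at ha
          have := hG'.2 a ha
          simpa [hu0] using this
        · exact absurd (h0s c a hc) ha
      · exact absurd (h0s c a hc.ne') ha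
    · have hn := hu _ t.succ_ne_zero
      have hd : (u + Pi.single 0 D : Fin (ℓ + 1) → ℕ) t.succ = u t.succ := by simp
      rw [hd]
      refine ⟨⟨0, by rw [id, hss]; simp, by simp⟩, fun c => ?_, fun c => ?_⟩
      · refine Fin.cases (fun a ha => ?_) (fun s a ha => ?_) c
        · have := hs0 t a ha
          omega
        · rw [hss] at ha
          obtain ⟨rfl, rfl⟩ := (ite_ne_right_iff.1 ha).1
          simp
      · refine Fin.cases (fun a hc => absurd hc (by simp)) (fun s a hc ha => ?_) c
        rw [hss] at ha
        obtain ⟨rfl, rfl⟩ := (ite_ne_right_iff.1 ha).1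
        exact absurd hc (lt_irrefl _)
  · revert ha
    refine Fin.cases (fun ha => ?_) (fun t => Fin.cases (fun _ => Or.inl rfl) (fun s ha => ?_) c) i
    · by_contra hcon
      push Not at hcon
      exact ha (h0s c a hcon.1)
    · rw [hss] at ha
      exact Or.inr (Or.inl (by rw [(ite_ne_right_iff.1 ha).1.1]))
  · simpa [hu0] using hD
  · simp only [Pi.add_apply, Finset.sum_add_distrib, Finset.sum_pi_single', Finset.mem_univ,
      if_true]
    omega

variable [DecidableEq K]

/-- The final shift exceeds `mvShift ℓ k` by `n` in every position, so passing to `mvShift ℓ k`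
keeps the leading positions and lowers each degree by `n`. The bound on the sum of degrees is kept
for the averaging argument. -/
theorem mvWalk_spec {k n D : ℕ} {G : SkewPolynomial K} {R : Fin ℓ → SkewPolynomial K}
    {V : PolyMatrix K ℓ} (hℓ : 0 < ℓ) (hk : (ℓ + 1).choose 2 * (k - 1) < n)
    (hV : toMatrix V = mvMatrix G R) (hG : degree G = D) (hD : D ≤ n)
    (hR : ∀ t, degree (R t) < n) :
    ∃ (g : Fin (ℓ + 1) → Fin (ℓ + 1)) (e : Fin (ℓ + 1) → ℕ), Function.Injective g ∧
      (∀ j, IsLead (mvShift ℓ k) ((mvWalk (fieldOps K) k n V).val j) (g j) (e j)) ∧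
      ∑ j, e j ≤ n + ∑ c, mvShift ℓ k c ∧
      rowSpace (toMatrix (mvWalk (fieldOps K) k n V).val) = rowSpace (mvMatrix G R) ∧
      (mvWalk (fieldOps K) k n V).ops ≤ 26 * (ℓ * n ^ 2) := by
  have hu : ∀ c : Fin (ℓ + 1), c ≠ 0 →
      (mvShift ℓ k + fun t => if t = 0 then 0 else n : Fin (ℓ + 1) → ℕ) c =
        n + c * (k - 1) := fun c hc => by
    simp only [mvShift, Pi.add_apply, if_neg hc]
    exact Nat.add_comm _ _
  have h0 := walkState_mvMatrix (u := mvShift ℓ k + fun t => if t = 0 then 0 else n) hV hG hD hR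
    (by simp [mvShift]) fun c hc => by rw [hu c hc]; exact Nat.le_add_right _ _
  obtain ⟨g, d, t, T, h1, h2, h3⟩ := h0.walkSteps hℓ hk n hu
  have hshift : (mvShift ℓ k + (fun t : Fin (ℓ + 1) => if t = 0 then 0 else n)) +
      Pi.single 0 n = fun c => mvShift ℓ k c + n := by
    funext c
    by_cases hc : c = 0
    · simp [hc]
    · simp [hc]
  rw [hshift] at h1
  have hge : ∀ j, n ≤ d j := fun j => by
    obtain ⟨a, -, ha⟩ := (h1.lead j).attained
    omega
  refine ⟨g, fun j => d j - n, h1.inj, fun j => ?_, ?_, h2.trans (by rw [hV]), ?_⟩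
  · have := hge j
    refine ⟨?_, fun c a ha => ?_, fun c a hc ha => ?_⟩
    · obtain ⟨a, ha, hae⟩ := (h1.lead j).attained
      exact ⟨a, ha, by beta_reduce; omega⟩
    · have := (h1.lead j).le c a ha
      beta_reduce
      omega
    · have := (h1.lead j).lt c a hc ha
      beta_reduce
      omega
  · beta_reduce
    have h4 : ∑ j, (d j - n) + (ℓ + 1) * n = ∑ j, d j := by
      have hn : ∑ _j : Fin (ℓ + 1), n = (ℓ + 1) * n := by simp
      rw [← hn, ← Finset.sum_add_distrib]
      exact Finset.sum_congr rfl fun j _ => Nat.sub_add_cancel (hge j)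
    have h5 := h1.sum_le
    rw [Finset.sum_add_distrib, Finset.sum_const, Finset.card_univ, Fintype.card_fin,
      smul_eq_mul] at h5
    omega
  · refine h3.trans (le_of_eq ?_)
    ring

theorem isShiftedWeakPopov_of_isLead {w : Fin (ℓ + 1) → ℕ} {V : PolyMatrix K ℓ}
    {g : Fin (ℓ + 1) → Fin (ℓ + 1)} {e : Fin (ℓ + 1) → ℕ} (hg : Function.Injective g)
    (h : ∀ j, IsLead w (V j) (g j) (e j)) : IsShiftedWeakPopov w (toMatrix V) := by
  have hdeg : ∀ i, (fun c => degree (shiftRow w (toMatrix V i) c)) =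
      shiftedDegrees (fieldOps K) w (V i) := fun i => by
    funext c
    rw [shiftRow, degree_mul_X_pow, toMatrix, degree_toSkew]
    rfl
  intro i j _ _ hij
  simp only [hdeg, (h _).leadingPosition] at hij
  exact hg (WithBot.coe_injective hij)

end MvWalk

open SkewPolynomial

theorem toSkew_coeff_lt {K : Type*} [Field K] {p : List K} {m : ℕ}
    (hm : (toSkew p).coeff m ≠ 0) : m < p.length := by
  by_contra h
  rw [toSkew_coeff, List.getD_eq_default _ _ (not_lt.1 h)] at hm
  exact hm rfl

/-! ### Operator evaluation. -/

section Evaluation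

variable {K : Type*} [Field K] [MulSemiringAction (Multiplicative ℕ) K]

theorem evalAt_add_left (f g : SkewPolynomial K) (α : K) :
    evalAt (f + g) α = evalAt f α + evalAt g α :=
  SkewPolynomial.sum_add_index f g _ (fun _ => zero_mul _) fun _ _ _ => add_mul _ _ _

theorem evalAt_monomial (m : ℕ) (a α : K) :
    evalAt (monomial m a) α = a * (Multiplicative.ofAdd m • α) :=
  SkewPolynomial.sum_monomial_index (zero_mul _)

theorem evalAt_add_right (f : SkewPolynomial K) (α β : K) :
    evalAt f (α + β) = evalAt f α + evalAt f β := by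
  simp [evalAt, SkewPolynomial.sum_def, mul_add, Finset.sum_add_distrib]

theorem evalAt_zero_right (f : SkewPolynomial K) : evalAt f 0 = 0 := by
  simp [evalAt, SkewPolynomial.sum_def]

theorem evalAt_sum_right {ι : Type*} (f : SkewPolynomial K) (s : Finset ι) (v : ι → K) :
    evalAt f (∑ i ∈ s, v i) = ∑ i ∈ s, evalAt f (v i) :=
  map_sum (⟨⟨evalAt f, evalAt_zero_right f⟩, evalAt_add_right f⟩ : K →+ K) v s

/-- Products become compositions of operators; hence left multiples of a vector satisfying the
interpolation conditions satisfy them too. By additivity it suffices to check monomials. -/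
theorem evalAt_mul (f g : SkewPolynomial K) (α : K) :
    evalAt (f * g) α = evalAt f (evalAt g α) := by
  induction f using SkewPolynomial.induction with
  | h0 => simp [evalAt, SkewPolynomial.sum_def]
  | ha n r q _ _ ih =>
    rw [add_mul, evalAt_add_left, evalAt_add_left, ih]
    congr 1
    clear ih
    induction g using SkewPolynomial.induction with
    | h0 => simp [evalAt, SkewPolynomial.sum_def]
    | ha m s g _ _ ihg =>
      rw [mul_add, evalAt_add_left, evalAt_add_left (monomial m s), evalAt_add_right, ihg,
        monomial_mul_monomial, evalAt_monomial, evalAt_monomial m s α,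
        evalAt_monomial, evalAt_monomial, φ_iterate_apply, smul_mul', smul_smul, ← ofAdd_add, mul_assoc]

theorem evalAt_fixed_mul (f : SkewPolynomial K) {c : K}
    (hc : ∀ m : Multiplicative ℕ, m • c = c) (α : K) : evalAt f (c * α) = c * evalAt f α := by
  simp only [evalAt, SkewPolynomial.sum_def, Finset.mul_sum, smul_mul', hc]
  exact Finset.sum_congr rfl fun i _ => by ring

theorem evalAt_eq_sum_range (f : SkewPolynomial K) {n : ℕ} (hf : ∀ m, f.coeff m ≠ 0 → m < n)
    (α : K) : evalAt f α = ∑ m ∈ Finset.range n, f.coeff m * (Multiplicative.ofAdd m • α) :=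
  SkewPolynomial.sum_eq_of_subset _ (fun _ => zero_mul _) fun m hm =>
    Finset.mem_range.2 (hf m (SkewPolynomial.mem_support_iff.1 hm))

/-- `θ` generates the action, so being fixed by `θ` alone puts an element in the fixed field. -/
theorem fixed_of_smul_eq {c : K} (hc : Multiplicative.ofAdd 1 • c = c) (m : Multiplicative ℕ) :
    m • c = c := by
  rw [← SkewPolynomial.φ_iterate_apply 1] at hc
  have := SkewPolynomial.φ_iterate_apply m.toAdd c
  rw [ofAdd_toAdd] at this
  rw [← this]
  exact Function.iterate_fixed hc _

variable [DecidableEq K]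

theorem evalList_ops (a : K) (i : ℕ) (p : List K) :
    (evalList (fieldOps K) a i p).ops = 3 * p.length := by
  induction p generalizing i with
  | nil => simp [evalList]
  | cons c p ih =>
    simp [evalList, ih]
    ring

theorem evalList_val (a : K) (i : ℕ) (p : List K) :
    (evalList (fieldOps K) a i p).val =
      ∑ m ∈ Finset.range p.length, p.getD m 0 * (Multiplicative.ofAdd (m + i) • a) := by
  induction p generalizing i with
  | nil => simp [evalList]
  | cons c p ih =>
    rw [List.length_cons, Finset.sum_range_succ']
    simp only [evalList, Counted.bind_val, ih, fieldOps_theta, fieldOps_mul, fieldOps_add,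
      List.getD_cons_succ, List.getD_cons_zero, zero_add, add_assoc, add_comm 1 i]
    exact add_comm _ _

theorem evalList_zero_val (a : K) (p : List K) :
    (evalList (fieldOps K) a 0 p).val = evalAt (toSkew p) a := by
  rw [evalList_val, evalAt_eq_sum_range _ (fun m hm => toSkew_coeff_lt hm)]
  simp only [toSkew_coeff, add_zero]

theorem mulX_spec (p : List K) : (mulX (fieldOps K) p).val =
    0 :: p.map (fun a => Multiplicative.ofAdd 1 • a) ∧ (mulX (fieldOps K) p).ops = p.length := by
  have h : (p.foldr (fun a (acc : Counted (List K)) => do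
      let r ← acc
      let s ← (fieldOps K).theta 1 a
      pure (s :: r)) (pure [])) = ⟨p.map (fun a => Multiplicative.ofAdd 1 • a), p.length⟩ := by
    induction p with
    | nil => rfl
    | cons a p ih =>
      rw [List.foldr_cons, ih]
      rfl
  unfold mulX
  rw [h]
  exact ⟨rfl, rfl⟩

theorem toSkew_mulX (p : List K) : toSkew (mulX (fieldOps K) p).val = X * toSkew p := by
  ext m
  rw [(mulX_spec p).1, ← monomial_one_one_eq_X, coeff_monomial_mul, toSkew_coeff, toSkew_coeff]
  cases m with
  | zero => simp
  | succ m =>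
    have h := List.getD_map (n := m) (l := p) (d := (0 : K))
      (fun a : K => Multiplicative.ofAdd 1 • a)
    simp only [smul_zero] at h
    rw [List.getD_cons_succ, h]
    simp

end Evaluation

/-! ### Newton interpolation. -/

section Newton

variable {K : Type*} [Field K] [MulSemiringAction (Multiplicative ℕ) K]

/-- `A` is the annihilator polynomial and `R` the interpolation polynomial of the points `seen`. -/
structure NewtonState (seen : List (K × K)) (A R : List K) : Prop where
  length_A : A.length = seen.length + 1
  length_R : R.length = seen.length
  monic : A.getD seen.length 0 = 1
  eval_A : ∀ z ∈ seen, evalAt (toSkew A) z.1 = 0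
  eval_R : ∀ z ∈ seen, evalAt (toSkew R) z.1 = z.2
  ker : ∀ z, evalAt (toSkew A) z = 0 →
    z ∈ Submodule.span (FixedPoints.subfield (Multiplicative ℕ) K) {a | a ∈ seen.map Prod.fst}

theorem newtonState_nil : NewtonState ([] : List (K × K)) [1] [] := by
  refine ⟨rfl, rfl, rfl, by simp, by simp, fun z hz => ?_⟩
  rw [evalAt_eq_sum_range (toSkew [1]) (n := 1)
    (fun m hm => toSkew_coeff_lt (p := [1]) hm)] at hz
  simp [toSkew_coeff] at hz
  simp [hz]

/-- The first components of the points are distinct and independent over the fixed field. -/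
def IndepPoints (pts : List (K × K)) : Prop :=
  (pts.map Prod.fst).Nodup ∧
    LinearIndepOn (FixedPoints.subfield (Multiplicative ℕ) K) id {a | a ∈ pts.map Prod.fst}

/-- Together with the field `ker` of `NewtonState` this shows that `A` does not vanish at the next
point, so Newton's divisions are legitimate. -/
theorem IndepPoints.notMem_span {seen pts : List (K × K)} {z : K × K}
    (h : IndepPoints (seen ++ z :: pts)) :
    z.1 ∉ Submodule.span (FixedPoints.subfield (Multiplicative ℕ) K)
      {a | a ∈ seen.map Prod.fst} := by
  have hz : z.1 ∉ {a | a ∈ seen.map Prod.fst} := fun hmem => by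
    have := h.1
    rw [List.map_append, List.map_cons, List.nodup_append] at this
    exact this.2.2 _ hmem _ List.mem_cons_self rfl
  refine ((linearIndepOn_id_insert hz).1 (h.2.mono ?_)).2
  rintro a (rfl | ha)
  · simp
  · simp only [Set.mem_ofPred_eq, List.map_append, List.mem_append] at ha ⊢
    exact Or.inl ha

theorem indepPoints_ofFn {n : ℕ} {x : Fin n → K} (y : Fin n → K)
    (hx : LinearIndependent (FixedPoints.subfield (Multiplicative ℕ) K) x) :
    IndepPoints (List.ofFn fun i => (x i, y i)) := by
  have hmap : (List.ofFn fun i => (x i, y i)).map Prod.fst = List.ofFn x := by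
    rw [List.map_ofFn]
    rfl
  refine ⟨?_, ?_⟩
  · rw [hmap, List.nodup_ofFn]
    exact hx.injective
  · rw [hmap]
    convert hx.linearIndepOn_id using 1
    ext a
    simp [List.mem_ofFn]

variable [DecidableEq K]

theorem NewtonState.step {seen : List (K × K)} {A R : List K} {a b : K}
    (h : NewtonState seen A R)
    (ha : a ∉ Submodule.span (FixedPoints.subfield (Multiplicative ℕ) K)
      {a | a ∈ seen.map Prod.fst}) :
    NewtonState (seen ++ [(a, b)])
      (subMonomialMul (fieldOps K)
        ((Multiplicative.ofAdd 1 • evalAt (toSkew A) a) / evalAt (toSkew A) a) 0 A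
        (mulX (fieldOps K) A).val).val
      (subMonomialMul (fieldOps K)
        ((evalAt (toSkew R) a - b) / evalAt (toSkew A) a) 0 A R).val := by
  set e := evalAt (toSkew A) a with he
  have he0 : e ≠ 0 := fun h0 => ha (h.ker a h0)
  have hX : (mulX (fieldOps K) A).val.length = seen.length + 2 := by
    rw [(mulX_spec A).1, List.length_cons, List.length_map, h.length_A]
  have hevalA : ∀ z, evalAt (toSkew (subMonomialMul (fieldOps K)
      ((Multiplicative.ofAdd 1 • e) / e) 0 A (mulX (fieldOps K) A).val).val) z =
      Multiplicative.ofAdd 1 • evalAt (toSkew A) z -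
        (Multiplicative.ofAdd 1 • e) / e * evalAt (toSkew A) z := by
    intro z
    rw [toSkew_subMonomialMul, toSkew_mulX, sub_eq_add_neg, ← neg_mul, ← monomial_neg,
      evalAt_add_left, evalAt_mul, evalAt_mul, evalAt_monomial, ← monomial_one_one_eq_X,
      evalAt_monomial]
    simp [sub_eq_add_neg]
  have hevalR : ∀ z, evalAt (toSkew (subMonomialMul (fieldOps K)
      ((evalAt (toSkew R) a - b) / e) 0 A R).val) z =
      evalAt (toSkew R) z - (evalAt (toSkew R) a - b) / e * evalAt (toSkew A) z := by
    intro z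
    rw [toSkew_subMonomialMul, sub_eq_add_neg, ← neg_mul, ← monomial_neg,
      evalAt_add_left, evalAt_mul, evalAt_monomial]
    simp [sub_eq_add_neg]
  refine ⟨?_, ?_, ?_, ?_, ?_, ?_⟩
  · rw [subMonomialMul_zero_length, hX, h.length_A, List.length_append, List.length_singleton]
    omega
  · rw [subMonomialMul_zero_length, h.length_A, h.length_R, List.length_append,
      List.length_singleton]
    omega
  -- The index is one past the end of `A`, where `getD` gives `0`; the new leading coefficient is
  -- that of `x · A`, namely `θ(1) = 1`.
  · rw [List.length_append, List.length_singleton, subMonomialMul_getD, if_pos (Nat.zero_le _),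
      Nat.sub_zero, List.getD_eq_default A _ (by rw [h.length_A]), ← toSkew_coeff, toSkew_mulX,
      ← monomial_one_one_eq_X, coeff_monomial_mul, if_pos (Nat.le_add_left _ _),
      Nat.add_sub_cancel, toSkew_coeff, h.monic]
    simp
  · intro z hz
    rw [hevalA]
    rcases List.mem_append.1 hz with hz | hz
    · rw [h.eval_A z hz]
      simp
    · rw [List.mem_singleton.1 hz, ← he, div_mul_cancel₀ _ he0, sub_self]
  · intro z hz
    rw [hevalR]
    rcases List.mem_append.1 hz with hz | hz
    · rw [h.eval_A z hz, h.eval_R z hz]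
      simp
    · rw [List.mem_singleton.1 hz, ← he, div_mul_cancel₀ _ he0, sub_sub_cancel]
  · intro z hz
    rw [hevalA] at hz
    -- If the new polynomial kills `z`, then `c = A(z) / A(a)` is fixed by `θ`. Linearity over the
    -- fixed field gives `A(z - c a) = 0`, so `z` lies in the span of the seen points and `a`.
    have hfix : Multiplicative.ofAdd 1 • (evalAt (toSkew A) z / e) = evalAt (toSkew A) z / e := by
      have hθ : Multiplicative.ofAdd 1 • e ≠ 0 :=
        fun h0 => he0 ((smul_eq_zero_iff_of_field _ _).1 h0)
      have hmul : Multiplicative.ofAdd 1 • (evalAt (toSkew A) z / e) * Multiplicative.ofAdd 1 • e =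
          Multiplicative.ofAdd 1 • evalAt (toSkew A) z := by
        rw [← smul_mul', div_mul_cancel₀ _ he0]
      rw [eq_div_of_mul_eq hθ hmul, sub_eq_zero.1 hz]
      field_simp
    set c := evalAt (toSkew A) z / e with hc
    have hker := h.ker (z + -c * a) (by
      rw [evalAt_add_right, evalAt_fixed_mul _ (fun m => by
        rw [smul_neg, fixed_of_smul_eq hfix]), ← he, hc, neg_mul, div_mul_cancel₀ _ he0]
      ring)
    let c' : FixedPoints.subfield (Multiplicative ℕ) K := ⟨c, fun m => fixed_of_smul_eq hfix m⟩
    have hsub : {a | a ∈ seen.map Prod.fst} ⊆ {a' | a' ∈ (seen ++ [(a, b)]).map Prod.fst} := by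
      intro w hw
      simp only [Set.mem_ofPred_eq, List.map_append, List.mem_append] at hw ⊢
      exact Or.inl hw
    have h2 : c' • a ∈ Submodule.span (FixedPoints.subfield (Multiplicative ℕ) K)
        {a' | a' ∈ (seen ++ [(a, b)]).map Prod.fst} :=
      Submodule.smul_mem _ _ (Submodule.subset_span (by simp))
    have h3 := Submodule.add_mem _ (Submodule.span_mono hsub hker) h2
    have h4 : z + -c * a + c' • a = z := by
      change z + -c * a + c * a = z
      ring
    rwa [h4] at h3

/-- With `s` points seen, the next one costs at most `13 s + 14`: `6 s + 3` for the evaluations, `6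
s + 6` for the two subtractions, `s + 1` for `x · A` and `4` scalar operations. -/
theorem newton_spec (pts : List (K × K)) {seen : List (K × K)} {A R : List K}
    (h : NewtonState seen A R) (hind : IndepPoints (seen ++ pts)) :
    NewtonState (seen ++ pts) (newton (fieldOps K) pts A R).val.1
      (newton (fieldOps K) pts A R).val.2 ∧
    (newton (fieldOps K) pts A R).ops ≤ pts.length * (14 * (seen.length + pts.length)) := by
  induction pts generalizing seen A R with
  | nil => simpa [newton] using h
  | cons z pts ih =>
    obtain ⟨a, b⟩ := z
    have h1 := h.step (b := b) hind.notMem_span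
    obtain ⟨h2, h3⟩ := ih h1 (by rwa [List.append_assoc, List.singleton_append])
    rw [List.append_assoc, List.singleton_append] at h2
    have hnnz := nnz_le_length A
    have hA := h.length_A
    have hR := h.length_R
    simp only [newton, Counted.bind_val, Counted.bind_ops, fieldOps_sub, fieldOps_div,
      fieldOps_theta, evalList_zero_val, evalList_ops, subMonomialMul_ops, (mulX_spec A).2]
    refine ⟨h2, ?_⟩
    simp only [List.length_append, List.length_cons, List.length_nil, zero_add] at h3 ⊢
    have h4 : (pts.length + 1) * (14 * (seen.length + (pts.length + 1))) =
        pts.length * (14 * (seen.length + 1 + pts.length)) +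
          14 * (seen.length + 1 + pts.length) := by ring
    omega

end Newton

theorem toSkew_nil {K : Type*} [Field K] : toSkew ([] : List K) = 0 := by
  simp [toSkew]

theorem toSkew_one {K : Type*} [Field K] : toSkew ([1] : List K) = 1 := by
  simp [toSkew, C_1]

/-! ### The explicit basis and the interpolation problem. -/

section Interpolation

variable {K : Type*} [Field K] [MulSemiringAction (Multiplicative ℕ) K] {n ℓ : ℕ} {x : Fin n → K}

theorem NewtonState.isInterpolationPoly {y : Fin n → K} {A R : List K}
    (h : NewtonState (List.ofFn fun i => (x i, y i)) A R) :
    IsInterpolationPoly x y (toSkew R) := by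
  have hlen := h.length_R
  rw [List.length_ofFn] at hlen
  refine ⟨?_, fun i => h.eval_R (x i, y i) (List.mem_ofFn.2 ⟨i, rfl⟩)⟩
  refine (Finset.sup_lt_iff (WithBot.bot_lt_coe n)).2 fun m hm => ?_
  have := toSkew_coeff_lt (SkewPolynomial.mem_support_iff.1 hm)
  rw [hlen] at this
  exact WithBot.coe_lt_coe.2 this

section Basis

variable [DecidableEq K]

theorem newton_ofFn_spec (hx : LinearIndependent (FixedPoints.subfield (Multiplicative ℕ) K) x)
    (y : Fin n → K) :
    NewtonState (List.ofFn fun i => (x i, y i))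
      (newton (fieldOps K) (List.ofFn fun i => (x i, y i)) [1] []).val.1
      (newton (fieldOps K) (List.ofFn fun i => (x i, y i)) [1] []).val.2 ∧
    (newton (fieldOps K) (List.ofFn fun i => (x i, y i)) [1] []).ops ≤ 14 * n ^ 2 := by
  obtain ⟨h1, h2⟩ := newton_spec (List.ofFn fun i => (x i, y i)) newtonState_nil
    (by simpa using indepPoints_ofFn y hx)
  refine ⟨by simpa using h1, h2.trans (le_of_eq ?_)⟩
  rw [List.length_ofFn, List.length_nil]
  ring

end Basis

/-- A polynomial of degree less than `n` that vanishes at `n` independent points is zero. -/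
theorem eq_zero_of_evalAt_eq_zero
    (hx : LinearIndependent (FixedPoints.subfield (Multiplicative ℕ) K) x)
    {B : SkewPolynomial K} (hB : ∀ m, B.coeff m ≠ 0 → m < n) (h0 : ∀ i, evalAt B (x i) = 0) :
    B = 0 := by
  classical
  let Φ : (Fin n → K) →ₗ[K] (Fin n → K) :=
    { toFun := fun b i => ∑ m : Fin n, b m * (Multiplicative.ofAdd (m : ℕ) • x i)
      map_add' := fun b c => by
        funext i
        simp [add_mul, Finset.sum_add_distrib]
      map_smul' := fun r b => by
        funext i
        simp [Finset.mul_sum, mul_assoc] }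
  have hΦ : ∀ (f : SkewPolynomial K), (∀ m, f.coeff m ≠ 0 → m < n) →
      ∀ i, Φ (fun m => f.coeff m) i = evalAt f (x i) := fun f hf i => by
    rw [evalAt_eq_sum_range f hf, Finset.sum_range]
    rfl
  have hsurj : Function.Surjective Φ := fun y => by
    have h := (newton_ofFn_spec hx y).1
    refine ⟨fun m => (toSkew (newton (fieldOps K)
      (List.ofFn fun i => (x i, y i)) [1] []).val.2).coeff m, funext fun i => ?_⟩
    rw [hΦ _ (fun m hm => ?_) i]
    · exact h.isInterpolationPoly.2 i
    · have := toSkew_coeff_lt hm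
      rwa [h.length_R, List.length_ofFn] at this
  -- Newton interpolation reaches every vector of values, so the evaluation map, an endomorphism of
  -- `K^n`, is also injective.
  have hinj := LinearMap.injective_iff_surjective.2 hsurj
  have hz : (fun m : Fin n => B.coeff m) = 0 := hinj (by
    rw [map_zero]
    funext i
    rw [hΦ B hB, h0]
    rfl)
  ext m
  by_contra hm
  exact hm (congrFun hz ⟨m, hB m hm⟩)

theorem NewtonState.degree_toSkew {y : Fin n → K} {A R : List K}
    (h : NewtonState (List.ofFn fun i => (x i, y i)) A R) : degree (toSkew A) = n := by
  have hlen := h.length_A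
  have hmonic := h.monic
  rw [List.length_ofFn] at hlen hmonic
  refine degree_eq_coe_iff.2 ⟨by rw [toSkew_coeff, hmonic]; exact one_ne_zero, fun m hm => ?_⟩
  have := toSkew_coeff_lt hm
  omega

/-- The left module of all vectors `Q` with `Q_0(x_i) + ∑ t, Q_t(y_{i,t}) = 0` for all `i`. -/
noncomputable def interpolationModule (x : Fin n → K) (y : Fin n → Fin ℓ → K) :
    Submodule (SkewPolynomial K) (Fin (ℓ + 1) → SkewPolynomial K) where
  carrier := {Q | ∀ i, evalAt (Q 0) (x i) + ∑ t : Fin ℓ, evalAt (Q t.succ) (y i t) = 0}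
  zero_mem' i := by simp [evalAt, SkewPolynomial.sum_def]
  add_mem' {P Q} hP hQ i := by
    simp only [Pi.add_apply, evalAt_add_left, Finset.sum_add_distrib]
    rw [add_add_add_comm, hP i, hQ i, add_zero]
  smul_mem' f Q hQ i := by
    simp only [Pi.smul_apply, smul_eq_mul, evalAt_mul]
    rw [← evalAt_sum_right, ← evalAt_add_right, hQ i, evalAt_zero_right]

theorem rowSpace_mvMatrix_le {G : SkewPolynomial K} {R : Fin ℓ → SkewPolynomial K}
    {y : Fin n → Fin ℓ → K} (hG : IsAnnihilatorPoly x G)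
    (hR : ∀ t, IsInterpolationPoly x (fun i => y i t) (R t)) :
    rowSpace (mvMatrix G R) ≤ interpolationModule x y := by
  have h0 : ∀ α : K, evalAt 0 α = 0 := fun α => by simp [evalAt, SkewPolynomial.sum_def]
  refine Submodule.span_le.2 ?_
  rintro _ ⟨j, rfl⟩ i
  refine Fin.cases ?_ (fun t => ?_) j
  · change evalAt G (x i) + ∑ t : Fin ℓ, evalAt 0 (y i t) = 0
    simp [h0, hG.2.1 i]
  · change evalAt (-R t) (x i) + ∑ s : Fin ℓ, evalAt (if s = t then 1 else 0) (y i s) = 0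
    have h1 : evalAt (-R t) (x i) = -evalAt (R t) (x i) := by
      have := evalAt_add_left (-R t) (R t) (x i)
      rw [neg_add_cancel, h0] at this
      exact eq_neg_of_add_eq_zero_left this.symm
    rw [h1, (hR t).2 i, Finset.sum_eq_single t]
    · rw [if_pos rfl, ← monomial_zero_one, evalAt_monomial]
      simp
    · intro s _ hs
      rw [if_neg hs, h0]
    · simp

theorem NewtonState.isAnnihilatorPoly
    (hx : LinearIndependent (FixedPoints.subfield (Multiplicative ℕ) K) x)
    {y : Fin n → K} {A R : List K} (h : NewtonState (List.ofFn fun i => (x i, y i)) A R) :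
    IsAnnihilatorPoly x (toSkew A) := by
  have hmonic := h.monic
  rw [List.length_ofFn] at hmonic
  refine ⟨⟨n, h.degree_toSkew, by rw [toSkew_coeff, hmonic]⟩,
    fun i => h.eval_A (x i, y i) (List.mem_ofFn.2 ⟨i, rfl⟩), fun B hB h0 => ?_⟩
  rw [h.degree_toSkew]
  by_contra hlt
  refine hB (eq_zero_of_evalAt_eq_zero hx (fun m hm => ?_) h0)
  have h1 := ((degree_le_iff B _).1 le_rfl m hm).trans_lt (not_le.1 hlt)
  exact_mod_cast h1

variable [DecidableEq K]

/-- By minimality the degree cannot exceed that of Newton's annihilator, which is `n`. -/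
theorem IsAnnihilatorPoly.exists_degree_eq
    (hx : LinearIndependent (FixedPoints.subfield (Multiplicative ℕ) K) x)
    {G : SkewPolynomial K} (hG : IsAnnihilatorPoly x G) : ∃ D : ℕ, degree G = D ∧ D ≤ n := by
  obtain ⟨⟨D, hD, -⟩, -, hmin⟩ := hG
  refine ⟨D, hD, ?_⟩
  have h := (newton_ofFn_spec hx fun _ => 0).1
  have hA := h.isAnnihilatorPoly hx
  have h1 := hmin _ (fun h0 => by
    have h2 := degree_eq_coe_iff.1 h.degree_toSkew
    rw [h0] at h2
    exact h2.1 rfl) hA.2.1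
  rw [hD, h.degree_toSkew] at h1
  exact_mod_cast h1

theorem toSkew_negList (p : List K) : toSkew (negList (fieldOps K) p).val = -toSkew p := by
  rw [negList, toSkew_subMonomialMul, toSkew_nil, zero_sub, fieldOps_one, monomial_zero_one,
    one_mul]

theorem mvBasis_spec (hx : LinearIndependent (FixedPoints.subfield (Multiplicative ℕ) K) x)
    (hℓ : 0 < ℓ) (hn : 0 < n) (y : Fin n → Fin ℓ → K) :
    (∃ (G : SkewPolynomial K) (R : Fin ℓ → SkewPolynomial K),
      IsAnnihilatorPoly x G ∧ (∀ t, IsInterpolationPoly x (fun i => y i t) (R t)) ∧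
      toMatrix (mvBasis (fieldOps K) x y).val = mvMatrix G R) ∧
    (mvBasis (fieldOps K) x y).ops ≤ 31 * (ℓ * n ^ 2) := by
  constructor
  · refine ⟨toSkew (newton (fieldOps K) (List.ofFn fun i => (x i, 0)) [1] []).val.1,
      fun t => toSkew (newton (fieldOps K) (List.ofFn fun i => (x i, y i t)) [1] []).val.2,
      (newton_ofFn_spec hx fun _ => 0).1.isAnnihilatorPoly hx,
      fun t => (newton_ofFn_spec hx fun i => y i t).1.isInterpolationPoly, ?_⟩
    funext i c
    refine Fin.cases (Fin.cases ?_ (fun c => ?_) c) (fun t => Fin.cases ?_ (fun s => ?_) c) i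
    · rfl
    · exact toSkew_nil
    · exact toSkew_negList _
    · change toSkew (if s = t then [1] else []) = if s = t then 1 else 0
      split_ifs
      · exact toSkew_one
      · exact toSkew_nil
  -- Each `R_t` costs `14 n²`, and its negation at most `3 n ≤ 3 n²`. With `14 n²` for `G` the total
  -- is at most `(14 + 17) ℓ n²`.
  · have h1 : ∀ t : Fin ℓ, (newton (fieldOps K) (List.ofFn fun i => (x i, y i t)) [1] []).ops +
        3 * nnz (newton (fieldOps K) (List.ofFn fun i => (x i, y i t)) [1] []).val.2 ≤
        17 * n ^ 2 := fun t => by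
      obtain ⟨h2, h3⟩ := newton_ofFn_spec hx fun i => y i t
      have h4 := nnz_le_length (newton (fieldOps K) (List.ofFn fun i => (x i, y i t)) [1] []).val.2
      rw [h2.length_R, List.length_ofFn] at h4
      nlinarith
    have h2 := Finset.sum_le_sum fun t (_ : t ∈ Finset.univ) => h1 t
    rw [Finset.sum_const, Finset.card_univ, Fintype.card_fin, smul_eq_mul] at h2
    have h3 := (newton_ofFn_spec hx fun _ => (0 : K)).2
    simp only [mvBasis, negList, Counted.pi, Counted.bind_ops, Counted.bind_val, Counted.pure_ops,
      add_zero, fieldOps_zero, fieldOps_one, subMonomialMul_ops]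
    have h4 : n ^ 2 ≤ ℓ * n ^ 2 := Nat.le_mul_of_pos_left _ hℓ
    linarith

theorem sum_mvShift (ℓ k : ℕ) : 2 * ∑ c, mvShift ℓ k c = (ℓ + 1) * ℓ * (k - 1) := by
  have h := Finset.sum_range_id_mul_two (ℓ + 1)
  rw [Nat.add_sub_cancel] at h
  simp only [mvShift]
  rw [← Finset.sum_mul, Fin.sum_univ_eq_sum_range (fun c => c) (ℓ + 1), ← h]
  ring

/-- The hypothesis says that `e` is at most the average `n / (ℓ + 1) + ℓ (k - 1) / 2`; the `n + 1`
in the definition of `χ` makes the inequality strict. -/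
theorem lt_chi {k e : ℕ} (hk : 0 < k) (he : (ℓ + 1) * e ≤ n + ∑ c, mvShift ℓ k c) :
    e < chi ℓ k n := by
  have h1 := sum_mvShift ℓ k
  have h2 : 2 * ((ℓ + 1) * e) ≤ 2 * n + (ℓ + 1) * ℓ * (k - 1) := by omega
  have h3 : (2 : ℚ) * ((ℓ + 1) * e) ≤ 2 * n + (ℓ + 1) * ℓ * (k - 1) := by
    have : ((2 * ((ℓ + 1) * e) : ℕ) : ℚ) ≤ ((2 * n + (ℓ + 1) * ℓ * (k - 1) : ℕ) : ℚ) := by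
      exact_mod_cast h2
    push_cast [Nat.cast_sub (Nat.succ_le_of_lt hk)] at this
    linarith
  rw [chi, Nat.lt_ceil]
  have hℓ : (0 : ℚ) < ℓ + 1 := by positivity
  have h4 : (e : ℚ) < ((n : ℚ) + 1 + (ℓ + 1) * (ℓ * (k - 1) / 2)) / (ℓ + 1) := by
    rw [lt_div_iff₀ hℓ]
    linarith
  rwa [add_div, mul_div_cancel_left₀ _ hℓ.ne'] at h4

theorem IsLead.sup_shiftedDegrees {u : Fin (ℓ + 1) → ℕ} {v : Fin (ℓ + 1) → List K}
    {h : Fin (ℓ + 1)} {e : ℕ} (hv : IsLead u v h e) :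
    Finset.univ.sup (shiftedDegrees (fieldOps K) u v) = e := by
  obtain ⟨h1, h2, -⟩ := isLead_iff_shiftedDegrees.1 hv
  exact le_antisymm (Finset.sup_le fun c _ => h2 c) (h1 ▸ Finset.le_sup (Finset.mem_univ h))

/-- A row of minimal shifted degree of a shifted weak Popov form of the explicit basis solves the
interpolation problem. -/
theorem solvesInterpolation_of_minimal {k : ℕ} (hk : 0 < k) {y : Fin n → Fin ℓ → K}
    {G : SkewPolynomial K} {R : Fin ℓ → SkewPolynomial K} (hG : IsAnnihilatorPoly x G)
    (hR : ∀ t, IsInterpolationPoly x (fun i => y i t) (R t)) {W : PolyMatrix K ℓ}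
    (hW : rowSpace (toMatrix W) = rowSpace (mvMatrix G R)) {g : Fin (ℓ + 1) → Fin (ℓ + 1)}
    {e : Fin (ℓ + 1) → ℕ} (hlead : ∀ j, IsLead (mvShift ℓ k) (W j) (g j) (e j))
    (hsum : ∑ j, e j ≤ n + ∑ c, mvShift ℓ k c) {j : Fin (ℓ + 1)} (hj : ∀ i, e j ≤ e i) :
    SolvesInterpolation k x y fun c => toSkew (W j c) := by
  refine ⟨fun h0 => ?_, ?_, fun t => ?_⟩
  · obtain ⟨a, ha, -⟩ := (hlead j).attained
    have := congrFun h0 (g j)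
    rw [← toSkew_coeff, this] at ha
    exact ha rfl
  · have hmem : toMatrix W j ∈ rowSpace (toMatrix W) := Submodule.subset_span ⟨j, rfl⟩
    rw [hW] at hmem
    exact rowSpace_mvMatrix_le hG hR hmem
  · have h1 := (isLead_iff_shiftedDegrees.1 (hlead j)).2.1 t
    rw [degree_toSkew]
    refine h1.trans_lt (Nat.cast_lt.2 (lt_chi hk ?_))
    refine le_trans (le_of_eq ?_) ((Finset.sum_le_sum fun i _ => hj i).trans hsum)
    simp

/-- The default `a` would be returned only for an empty list, which `hi` excludes. -/
theorem le_getD_argmin {α β : Type*} [LinearOrder β] (f : α → β) (l : List α) (a i : α)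
    (hi : i ∈ l) : f ((l.argmin f).getD a) ≤ f i := by
  cases h : l.argmin f with
  | none =>
    rw [List.argmin_eq_none.1 h] at hi
    cases hi
  | some j => exact List.le_of_mem_argmin hi h

end Interpolation

end SkewWalk

/-! ### The theorem. -/

open SkewWalk
theorem mainTheorem2 :
    ∃ C : ℕ, ∀ (K : Type*) [Field K] [Finite K] [DecidableEq K]
      [MulSemiringAction (Multiplicative ℕ) K] (ℓ k n : ℕ),
      0 < ℓ → 0 < k → 0 < n →
      (ℓ + 1).choose 2 * (k - 1) < n →
      n ≤ Module.finrank (FixedPoints.subfield (Multiplicative ℕ) K) K →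
      ∀ (x : Fin n → K) (y : Fin n → Fin ℓ → K),
        LinearIndependent (FixedPoints.subfield (Multiplicative ℕ) K) x →
        -- the weak Popov walk, started from any stored form of the explicit basis
        (∀ (G : SkewPolynomial K) (R : Fin ℓ → SkewPolynomial K),
          IsAnnihilatorPoly x G → (∀ t, IsInterpolationPoly x (fun i => y i t) (R t)) →
          ∀ M : PolyMatrix K ℓ, toMatrix M = mvMatrix G R →
            IsShiftedWeakPopovFormOf (mvShift ℓ k)
              (toMatrix (mvWalk (fieldOps K) k n M).val) (mvMatrix G R) ∧
            (mvWalk (fieldOps K) k n M).ops ≤ C * (ℓ * n ^ 2)) ∧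
        -- the interpolation step: it sets up the explicit basis, and solves the problem
        (∃ (G : SkewPolynomial K) (R : Fin ℓ → SkewPolynomial K),
          IsAnnihilatorPoly x G ∧ (∀ t, IsInterpolationPoly x (fun i => y i t) (R t)) ∧
          toMatrix (mvBasis (fieldOps K) x y).val = mvMatrix G R) ∧
        SolvesInterpolation k x y (fun c => toSkew ((mvInterpolation (fieldOps K) k x y).val c)) ∧
        (mvInterpolation (fieldOps K) k x y).ops ≤ C * (ℓ * n ^ 2) := by
  -- `57 = 31 + 26`: setting up the basis and walking.
  refine ⟨57, fun K _ _ _ _ ℓ k n hℓ hk hn hkn _ x y hx => ?_⟩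
  obtain ⟨⟨G, R, hG, hR, hM⟩, hops⟩ := mvBasis_spec hx hℓ hn y
  refine ⟨fun G' R' hG' hR' M hM' => ?_, ⟨G, R, hG, hR, hM⟩, ?_⟩
  · obtain ⟨D, hD, hDn⟩ := hG'.exists_degree_eq hx
    obtain ⟨g, e, hg, hlead, -, hrow, hcost⟩ :=
      mvWalk_spec hℓ hkn hM' hD hDn fun t => (hR' t).1
    exact ⟨⟨isShiftedWeakPopov_of_isLead hg hlead, hrow⟩,
      hcost.trans (Nat.mul_le_mul_right _ (by norm_num))⟩
  · obtain ⟨D, hD, hDn⟩ := hG.exists_degree_eq hx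
    obtain ⟨g, e, -, hlead, hsum, hrow, hcost⟩ :=
      mvWalk_spec hℓ hkn hM hD hDn fun t => (hR t).1
    refine ⟨?_, ?_⟩
    · refine solvesInterpolation_of_minimal hk hG hR hrow hlead hsum fun i => ?_
      have := le_getD_argmin (fun i => Finset.univ.sup (shiftedDegrees (fieldOps K) (mvShift ℓ k)
        ((mvWalk (fieldOps K) k n (mvBasis (fieldOps K) x y).val).val i)))
        (List.finRange (ℓ + 1)) 0 i (List.mem_finRange i)
      beta_reduce at this
      rw [(hlead i).sup_shiftedDegrees, (hlead _).sup_shiftedDegrees] at this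
      exact Nat.cast_le.1 this
    · change _ + (_ + 0) ≤ _
      omega
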